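/- Let $\mathcal T\subset\mathbb R^n$ be a nonempty closed set with compact boundary, and write $\mathbf d(x)$ for the distance of $x$ from $\mathcal T$. Let $f_0,f_1,\dots,f_m$ be vector fields that, for every bounded open $\Omega\subset\mathbb R^n$, are of class $C^1$ on $\Omega\setminus\mathcal T$ with $f_i$ and $Df_i$ bounded there. Consider the control system $$\dot y=f_0(y)+\sum_{i=1}^m a_if_i(y),\qquad y(0)=x\in\mathbb R^n\setminus\mathcal T,\qquad a\in A:=\{0,\pm e_1,\dots,\pm e_m\}.$$ With $[X,Y]=DY\cdot X-DX\cdot Y$ and $\chi$ the characteristic function of $\{f_0=0\}$, let $$\mathcal F^{(2)}=\{f_0,\ f_0-f_i,\ f_0+f_i\}\cup\{\pm[f_0,f_i]\chi,\ [f_j,f_\ell]\chi\}\quad(i,j,\ell=1,\dots,m),\qquad H^{(2)}(x,p)=\inf_{g\in\mathcal F^{(2)}}\langle p,g(x)\rangle .$$ A degree-$2$ control Lyapunov function is a continuous $U:\overline{\mathbb R^n\setminus\mathcal T}\to\mathbb R$ such that: $U>0$ on $\mathbb R^n\setminus\mathcal T$ and $U=0$ on $\partial\mathcal T$; $U^{-1}(K)$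 is compact for every compact $K\subset[0,\infty)$; for every compact $K\subset\mathbb R^n\setminus\mathcal T$ there is $\rho>0$ with $U(z_1)+U(z_2)-2U(\frac{z_1+z_2}2)\le\rho|z_1-z_2|^2$ whenever the segment $[z_1,z_2]$ lies in $K$; and $H^{(2)}(x,p)<0$ for all $x\in\mathbb R^n\setminus\mathcal T$ and all $p\in D^*U(x)$, where $D^*U(x)$ is the set of limits of $\nabla U(x_k)$ along sequences $x_k\to x$ of differentiability points $x_k\neq x$ of $U$ in $\mathbb R^n\setminus\mathcal T$. If a degree-$2$ control Lyapunov function exists, then the system is globally asymptotically controllable to $\mathcal T$. That is, there is a continuous $\beta:[0,\infty)^2\to[0,\infty)$ with $\beta(0,s)=0$ and $\beta(\cdot,s)$ strictly increasing and unbounded for each $s\ge0$, and with $\beta(\delta,\cdot)$ nonincreasing and $\beta(\delta,s)\to0$ as $s\to\infty$ for each $\delta\ge0$, such that for every $x\in\mathbb R^n\setminus\mathcal T$ there are a measurable control $\alpha:[0,\infty)\to A$, a time $T\in(0,\infty]$ and a (Carathéodory) solution $y:[0,T)\to\mathbb R^n\setminus\mathcal T$ of the system with control $\alpha$ and $y(0)=x$,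 satisfying $\lim_{t\to T^-}\mathbf d(y(t))=0$ and $\mathbf d(y(t))\le\beta(\mathbf d(x),t)$ for all $t\ge0$, where, if $T<\infty$, $y$ is prolonged by a constant point of $\partial\mathcal T$ on $[T,\infty)$. -/

import Mathlib

open Set Filter Topology MeasureTheory

namespace DriftCLF

/-- The state space `ℝⁿ` with its Euclidean norm and inner product. -/
abbrev State (n : ℕ) : Type := EuclideanSpace ℝ (Fin n)

/-- The vector field `g` is of class `C¹_b` on the (open) set `Ω`: it is `C¹` there and both `g`
and its derivative are bounded on `Ω`. -/
def IsCOneBounded {n : ℕ} (Ω : Set (State n)) (g : State n → State n) : Prop :=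
  ContDiffOn ℝ 1 g Ω ∧ ∃ M : ℝ, ∀ x ∈ Ω, ‖g x‖ ≤ M ∧ ‖fderiv ℝ g x‖ ≤ M

/-- The control set `A = {0, ±e₁, …, ±e_m}`. -/
def controlSet (m : ℕ) : Set (Fin m → ℝ) :=
  {a | a = 0 ∨ ∃ i : Fin m, a = Pi.single i 1 ∨ a = -Pi.single i 1}

/-- The right-hand side `f₀(y) + ∑ aᵢ fᵢ(y)` of the control system. -/
def dynamics {n m : ℕ} (f₀ : State n → State n) (f : Fin m → State n → State n)
    (y : State n) (a : Fin m → ℝ) : State n :=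
  f₀ y + ∑ i, a i • f i y

/-- `y` is a (Carathéodory) solution in `ℝⁿ ∖ 𝒯`, on `[0, T)`, of the control system with
control `α` and initial state `x`. -/
def IsSolution {n m : ℕ} (f₀ : State n → State n) (f : Fin m → State n → State n)
    (𝒯 : Set (State n)) (x : State n) (α : ℝ → Fin m → ℝ) (T : EReal) (y : ℝ → State n) : Prop :=
  ContinuousOn y {t : ℝ | 0 ≤ t ∧ (t : EReal) < T} ∧
  ∀ t : ℝ, 0 ≤ t → (t : EReal) < T →
    y t ∉ 𝒯 ∧
    IntervalIntegrable (fun s => dynamics f₀ f (y s) (α s)) volume 0 t ∧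
    y t = x + ∫ s in (0 : ℝ)..t, dynamics f₀ f (y s) (α s)

/-- Admissible trajectory-control pair issuing from `x`, with (possibly infinite) final time `T`:
the control is measurable with values in `A`, `y` solves the system on `[0, T)`, and the distance
of `y t` from the target tends to `0` as `t → T⁻`. -/
def IsAdmissible {n m : ℕ} (f₀ : State n → State n) (f : Fin m → State n → State n)
    (𝒯 : Set (State n)) (x : State n) (T : EReal) (y : ℝ → State n) (α : ℝ → Fin m → ℝ) : Prop :=
  Measurable α ∧ (∀ t : ℝ, 0 ≤ t → α t ∈ controlSet m) ∧
  0 < T ∧ IsSolution f₀ f 𝒯 x α T y ∧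
  ∀ ε : ℝ, 0 < ε → ∃ s : ℝ, 0 ≤ s ∧ (s : EReal) < T ∧
    ∀ t : ℝ, s < t → (t : EReal) < T → Metric.infDist (y t) 𝒯 < ε

/-- Functions of class `𝒦ℒ` on `[0, ∞) × [0, ∞)`. -/
structure IsKL (β : ℝ → ℝ → ℝ) : Prop where
  continuousOn : ContinuousOn (fun q : ℝ × ℝ => β q.1 q.2) (Ici 0 ×ˢ Ici 0)
  nonneg : ∀ δ s, 0 ≤ δ → 0 ≤ s → 0 ≤ β δ s
  zero_left : ∀ s, 0 ≤ s → β 0 s = 0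
  strictMonoOn : ∀ s, 0 ≤ s → StrictMonoOn (fun δ => β δ s) (Ici 0)
  unbounded : ∀ s, 0 ≤ s → ¬ BddAbove ((fun δ => β δ s) '' Ici 0)
  antitoneOn : ∀ δ, 0 ≤ δ → AntitoneOn (β δ) (Ici 0)
  tendsto_zero : ∀ δ, 0 ≤ δ → Tendsto (β δ) atTop (𝓝 0)

/-- Global asymptotic controllability to the target `𝒯`. When the final time `T` is finite the
trajectory is prolonged to `[T, ∞)` by a constant point of `∂𝒯`. -/
def IsGAC {n m : ℕ} (f₀ : State n → State n) (f : Fin m → State n → State n)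
    (𝒯 : Set (State n)) : Prop :=
  ∃ β : ℝ → ℝ → ℝ, IsKL β ∧
    ∀ x : State n, x ∉ 𝒯 →
      ∃ (T : EReal) (y : ℝ → State n) (α : ℝ → Fin m → ℝ),
        IsAdmissible f₀ f 𝒯 x T y α ∧
        (∃ z ∈ frontier 𝒯, ∀ t : ℝ, T ≤ (t : EReal) → y t = z) ∧
        ∀ t : ℝ, 0 ≤ t → Metric.infDist (y t) 𝒯 ≤ β (Metric.infDist x 𝒯) t

/-- Semiconcavity on an arbitrary set. -/
def IsSemiconcaveOn {n : ℕ} (Ω : Set (State n)) (F : State n → ℝ) : Prop :=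
  ContinuousOn F Ω ∧ ∃ ρ : ℝ, 0 < ρ ∧ ∀ z₁ ∈ Ω, ∀ z₂ ∈ Ω, segment ℝ z₁ z₂ ⊆ Ω →
    F z₁ + F z₂ - 2 * F (midpoint ℝ z₁ z₂) ≤ ρ * ‖z₁ - z₂‖ ^ 2

/-- Local semiconcavity: semiconcavity on every compact subset. -/
def IsLocallySemiconcaveOn {n : ℕ} (Ω : Set (State n)) (F : State n → ℝ) : Prop :=
  ∀ K : Set (State n), IsCompact K → K ⊆ Ω → IsSemiconcaveOn K F

/-- The set `D*F(x)` of limiting gradients at `x` of a function `F` on the open set `Ω`. -/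
def limitingGradients {n : ℕ} (Ω : Set (State n)) (F : State n → ℝ) (x : State n) :
    Set (State n) :=
  {w | ∃ u : ℕ → State n, (∀ k, u k ∈ Ω ∧ u k ≠ x ∧ DifferentiableAt ℝ F (u k)) ∧
    Tendsto u atTop (𝓝 x) ∧ Tendsto (fun k => gradient F (u k)) atTop (𝓝 w)}

/-- The family `{f₀, f₀ - fᵢ, f₀ + fᵢ}`. -/
def familyOne {n m : ℕ} (f₀ : State n → State n) (f : Fin m → State n → State n) :
    Set (State n → State n) :=
  {g | g = f₀ ∨ ∃ i : Fin m, g = f₀ - f i ∨ g = f₀ + f i}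

/-- The family of degree at most two: `familyOne` together with the brackets `±[f₀, fᵢ]` and
`[fⱼ, f_ℓ]`, each multiplied by the characteristic function of `{f₀ = 0}`. Here
`VectorField.lieBracket ℝ X Y x = DY(x) X(x) - DX(x) Y(x)`. -/
def familyTwo {n m : ℕ} (f₀ : State n → State n) (f : Fin m → State n → State n) :
    Set (State n → State n) :=
  familyOne f₀ f ∪
    {g | (∃ i : Fin m,
            g = indicator {x | f₀ x = 0} (VectorField.lieBracket ℝ f₀ (f i)) ∨
            g = indicator {x | f₀ x = 0} (-VectorField.lieBracket ℝ f₀ (f i))) ∨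
         ∃ j l : Fin m, g = indicator {x | f₀ x = 0} (VectorField.lieBracket ℝ (f j) (f l))}

/-- The degree-2 Hamiltonian: the infimum (over a finite nonempty family) of `⟨p, g(x)⟩`. -/
noncomputable def hamiltonianTwo {n m : ℕ} (f₀ : State n → State n)
    (f : Fin m → State n → State n) (x p : State n) : ℝ :=
  sInf ((fun g : State n → State n => inner ℝ p (g x)) '' familyTwo f₀ f)

/-- Degree-2 control Lyapunov functions. Only the values of `U` on `closure (ℝⁿ ∖ 𝒯)` matter. -/
structure IsDegreeTwoCLF {n m : ℕ} (f₀ : State n → State n) (f : Fin m → State n → State n)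
    (𝒯 : Set (State n)) (U : State n → ℝ) : Prop where
  continuousOn : ContinuousOn U (closure 𝒯ᶜ)
  semiconcave : IsLocallySemiconcaveOn 𝒯ᶜ U
  pos : ∀ x, x ∉ 𝒯 → 0 < U x
  zero_frontier : ∀ x ∈ frontier 𝒯, U x = 0
  proper : ∀ K : Set ℝ, IsCompact K → K ⊆ Ici 0 → IsCompact {x | x ∈ closure 𝒯ᶜ ∧ U x ∈ K}
  decrease : ∀ x, x ∉ 𝒯 → ∀ p ∈ limitingGradients 𝒯ᶜ U x, hamiltonianTwo f₀ f x p < 0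

end DriftCLF

namespace DriftCLF

/-! At each `x₀` some member of the family has negative product with a limiting gradient `p` of `U`.
If it is an admissible velocity, a short constant control displaces `x₀` by `t v + o(t)`. If it is a
bracket, then `f₀ x₀ = 0`, and a word of constant controls has no first-order displacement but a
chosen displacement `t² w + o(t²)` (`exists_steers`). The drift cannot be reversed, so the word for
`[fⱼ, f_ℓ]` also picks up terms `Df₀ · fⱼ` and `Df₀ · f_ℓ`. Two-letter words realize these
directions with both signs, so either one of them already decreases `U`, or both are orthogonal to
`p` and harmless. The fields are only `C¹`, but the expansion is taken at the single point `x₀`,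
where differentiability is enough (`isLittleO_flow`).

Semiconcavity gives, at every point, a limiting gradient `p` with `U z ≤ U x₀ + ⟨p, z - x₀⟩ + C ‖z -
x₀‖²` (`exists_limitingGradient`). The quadratic error is negligible against the displacement, so
`U` drops strictly along the word. The end point depends continuously on the initial point, so a
fixed drop persists near `x₀`; compactness of the bands `a ≤ U ≤ b` makes it uniform on each band.
Each step lasts at most one unit of time and `U` at most doubles during it.

Iterating such steps, the number of steps from `U ≤ b` to `U < a`, hence the time, is bounded
(`exists_iterate_lt`), while the doubling bound limits the overshoot. Properness of `U` and
compactness of `∂𝒯` translate this into uniform stability and attractivity for the distance, from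
which `exists_isKL_bound` builds `β`. -/

/-! ### Second-order expansion of the flow of a `C¹` vector field -/

section Flow

variable {E : Type*} [NormedAddCommGroup E] [NormedSpace ℝ E]

/-- One integral curve of `X` that starts at `z` and stays where `X` is close to its linearization
at `x₀`. -/
lemma norm_flow_sub_le {X : E → E} {x₀ z : E} {A : E →L[ℝ] E} {t M η B : ℝ} {y : ℝ → E}
    (ht : 0 ≤ t) (hη : 0 ≤ η) (hη1 : η ≤ 1)
    (hy0 : y 0 = z) (hy : ∀ s ∈ Icc 0 t, HasDerivWithinAt y (X (y s)) (Icc 0 t) s)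
    (hM : ∀ s ∈ Icc 0 t, ‖X (y s)‖ ≤ M)
    (hX : ∀ s ∈ Icc 0 t, ‖X (y s) - X x₀ - A (y s - x₀)‖ ≤ η * ‖y s - x₀‖)
    (hB : ‖z - x₀‖ + M * t ≤ B * t) :
    ‖y t - z - t • X x₀ - t • A (z - x₀) - (t ^ 2 / 2) • A (X x₀)‖
      ≤ (η * (B * t) + ‖A‖ * ((‖A‖ + 1) * (B * t) * t)) * t := by
  have hmem : t ∈ Icc 0 t := ⟨ht, le_rfl⟩
  have h0mem : (0 : ℝ) ∈ Icc 0 t := ⟨le_rfl, ht⟩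
  have hM0 : 0 ≤ M := (norm_nonneg _).trans (hM 0 h0mem)
  have hBt : 0 ≤ B * t := le_trans (by positivity) hB
  have h1 : ∀ s ∈ Icc 0 t, ‖y s - x₀‖ ≤ B * t := by
    intro s hs
    have h := (convex_Icc 0 t).norm_image_sub_le_of_norm_hasDerivWithin_le hy hM h0mem hs
    rw [hy0, sub_zero, Real.norm_of_nonneg hs.1] at h
    calc ‖y s - x₀‖ = ‖(y s - z) + (z - x₀)‖ := by congr 1; abel
      _ ≤ M * s + ‖z - x₀‖ := (norm_add_le _ _).trans (by gcongr)
      _ ≤ M * t + ‖z - x₀‖ := by gcongr; exact hs.2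
      _ ≤ B * t := by linarith
  have h2 : ∀ s ∈ Icc 0 t, ‖X (y s) - X x₀‖ ≤ (‖A‖ + 1) * (B * t) := by
    intro s hs
    calc ‖X (y s) - X x₀‖ = ‖(X (y s) - X x₀ - A (y s - x₀)) + A (y s - x₀)‖ := by congr 1; abel
      _ ≤ η * ‖y s - x₀‖ + ‖A‖ * ‖y s - x₀‖ :=
        (norm_add_le _ _).trans (add_le_add (hX s hs) (A.le_opNorm _))
      _ = (‖A‖ + η) * ‖y s - x₀‖ := by ring
      _ ≤ (‖A‖ + 1) * (B * t) := by gcongr; exact h1 s hs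
  have h3 : ∀ s ∈ Icc 0 t, ‖y s - z - s • X x₀‖ ≤ (‖A‖ + 1) * (B * t) * t := by
    intro s hs
    have hd : ∀ s ∈ Icc 0 t, HasDerivWithinAt (fun s => y s - s • X x₀) (X (y s) - X x₀)
        (Icc 0 t) s := fun s hs => by
      simpa using (hy s hs).fun_sub ((hasDerivWithinAt_id s _).smul_const (X x₀))
    have h := (convex_Icc 0 t).norm_image_sub_le_of_norm_hasDerivWithin_le hd h2 h0mem hs
    rw [sub_zero, Real.norm_of_nonneg hs.1, zero_smul, sub_zero, hy0] at h
    calc ‖y s - z - s • X x₀‖ = ‖y s - s • X x₀ - z‖ := by congr 1; abel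
      _ ≤ _ := h
      _ ≤ _ := by gcongr; exact hs.2
  have hd : ∀ s ∈ Icc 0 t, HasDerivWithinAt
      (fun s => y s - s • X x₀ - s • A (z - x₀) - (s ^ 2 / 2) • A (X x₀))
      (X (y s) - X x₀ - A (z - x₀) - s • A (X x₀)) (Icc 0 t) s := fun s hs => by
    have e1 := (hy s hs).fun_sub ((hasDerivWithinAt_id s _).smul_const (X x₀))
    have e2 := e1.fun_sub ((hasDerivWithinAt_id s _).smul_const (A (z - x₀)))
    have e3 : HasDerivWithinAt (fun s : ℝ => s ^ 2 / 2) s (Icc 0 t) s := by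
      simpa using ((hasDerivAt_pow 2 s).div_const 2).hasDerivWithinAt (s := Icc 0 t)
    simpa using e2.fun_sub (e3.smul_const (A (X x₀)))
  have hbd : ∀ s ∈ Icc 0 t, ‖X (y s) - X x₀ - A (z - x₀) - s • A (X x₀)‖
      ≤ η * (B * t) + ‖A‖ * ((‖A‖ + 1) * (B * t) * t) := by
    intro s hs
    -- The derivative of the remainder is the linearization error at `y s`, of size `η B t`, plus
    -- `A` applied to the first-order remainder of `y`, already known to be quadratic in `t`.
    have e : X (y s) - X x₀ - A (z - x₀) - s • A (X x₀)
        = (X (y s) - X x₀ - A (y s - x₀)) + A (y s - z - s • X x₀) := by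
      simp only [map_sub, map_smul]; abel
    rw [e]
    refine (norm_add_le _ _).trans (add_le_add ((hX s hs).trans ?_) ((A.le_opNorm _).trans ?_))
    · gcongr; exact h1 s hs
    · gcongr; exact h3 s hs
  have h := (convex_Icc 0 t).norm_image_sub_le_of_norm_hasDerivWithin_le hd hbd h0mem hmem
  rw [sub_zero, Real.norm_of_nonneg ht] at h
  convert h using 2
  simp [hy0]
  abel

/-- Second-order expansion of the end point of integral curves of `X` of duration `t`, issuing from
points `z t` that themselves have a second-order expansion at `x₀`. -/
lemma isLittleO_flow {X : E → E} {x₀ v w : E} (hX : DifferentiableAt ℝ X x₀)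
    {z : ℝ → E} {y : ℝ → ℝ → E}
    (hz : (fun t : ℝ => z t - x₀ - t • v - t ^ 2 • w) =o[𝓝[>] 0] fun t : ℝ => t ^ 2)
    (hy0 : ∀ᶠ t in 𝓝[>] 0, y t 0 = z t)
    (hy : ∀ᶠ t in 𝓝[>] 0, ∀ s ∈ Icc 0 t, HasDerivWithinAt (y t) (X (y t s)) (Icc 0 t) s)
    (hyV : ∀ V ∈ 𝓝 x₀, ∀ᶠ t in 𝓝[>] 0, ∀ s ∈ Icc 0 t, y t s ∈ V) :
    (fun t : ℝ => y t t - x₀ - t • (v + X x₀)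
      - t ^ 2 • (w + fderiv ℝ X x₀ v + (1 / 2 : ℝ) • fderiv ℝ X x₀ (X x₀)))
      =o[𝓝[>] 0] fun t : ℝ => t ^ 2 := by
  set A := fderiv ℝ X x₀ with hA
  set M := ‖X x₀‖ + 1 with hM
  -- `C t` bounds the distance of the initial points from `x₀`, `B t` that of the whole curves, and
  -- `K t³` collects the cubic errors.
  set C := ‖v‖ + ‖w‖ + 1 with hC
  set B := C + M with hB
  set K := ‖A‖ * (‖A‖ + 1) * B + ‖A‖ * (‖w‖ + 1) with hK
  have hC0 : 0 < C := by positivity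
  have hB0 : 0 < B := by positivity
  have hK0 : 0 ≤ K := by positivity
  rw [Asymptotics.isLittleO_iff]
  intro c hc
  set η := min 1 (c / (2 * (B + 1))) with hη
  have hη0 : 0 < η := by positivity
  have hη1 : η ≤ 1 := min_le_left _ _
  have hηc : η * (B + 1) ≤ c / 2 := by
    calc η * (B + 1) ≤ c / (2 * (B + 1)) * (B + 1) := by gcongr; exact min_le_right _ _
      _ = c / 2 := by field_simp
  have hV1 : ∀ᶠ u in 𝓝 x₀, ‖X u - X x₀ - A (u - x₀)‖ ≤ η * ‖u - x₀‖ :=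
    (Asymptotics.isLittleO_iff.1 hX.hasFDerivAt.isLittleO) hη0
  have hV2 : ∀ᶠ u in 𝓝 x₀, ‖X u‖ ≤ M := by
    have := hX.continuousAt.norm.eventually (gt_mem_nhds (lt_add_one ‖X x₀‖))
    exact this.mono fun u hu => hu.le
  have hsmall : ∀ᶠ t : ℝ in 𝓝[>] 0, t < min 1 (c / (2 * (K + 1))) :=
    nhdsWithin_le_nhds (gt_mem_nhds (by positivity))
  filter_upwards [hyV _ (hV1.and hV2), hy0, hy, hsmall, self_mem_nhdsWithin,
    (Asymptotics.isLittleO_iff.1 hz) hη0] with t htV ht0 htd htsmall htpos htz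
  have htpos : 0 < t := htpos
  have ht1 : t ≤ 1 := (htsmall.trans_le (min_le_left _ _)).le
  have htK : t * K ≤ c / 2 := by
    calc t * K ≤ c / (2 * (K + 1)) * (K + 1) := by
          gcongr
          · exact (htsmall.trans_le (min_le_right _ _)).le
          · linarith
      _ = c / 2 := by field_simp
  rw [Real.norm_of_nonneg (by positivity)] at htz ⊢
  have hz2 : ‖z t - x₀ - t • v‖ ≤ (‖w‖ + 1) * t ^ 2 := by
    calc ‖z t - x₀ - t • v‖ = ‖(z t - x₀ - t • v - t ^ 2 • w) + t ^ 2 • w‖ := by congr 1; abel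
      _ ≤ η * t ^ 2 + t ^ 2 * ‖w‖ := (norm_add_le _ _).trans (by
          rw [norm_smul (t ^ 2) w, Real.norm_of_nonneg (by positivity : (0 : ℝ) ≤ t ^ 2)]
          exact add_le_add htz le_rfl)
      _ ≤ 1 * t ^ 2 + t ^ 2 * ‖w‖ := by gcongr
      _ = _ := by ring
  have hz1 : ‖z t - x₀‖ ≤ C * t := by
    calc ‖z t - x₀‖ = ‖(z t - x₀ - t • v) + t • v‖ := by congr 1; abel
      _ ≤ (‖w‖ + 1) * t ^ 2 + t * ‖v‖ := (norm_add_le _ _).trans (by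
          rw [norm_smul t v, Real.norm_of_nonneg htpos.le]
          exact add_le_add hz2 le_rfl)
      _ ≤ (‖w‖ + 1) * (t * 1) + t * ‖v‖ := by rw [sq]; gcongr
      _ = C * t := by rw [hC]; ring
  have key := norm_flow_sub_le (A := A) (B := B) htpos.le hη0.le hη1 ht0 htd
    (fun s hs => (htV s hs).2) (fun s hs => (htV s hs).1) (by rw [hB]; linarith)
  have e : y t t - x₀ - t • (v + X x₀) - t ^ 2 • (w + A v + (1 / 2 : ℝ) • A (X x₀))
      = (y t t - z t - t • X x₀ - t • A (z t - x₀) - (t ^ 2 / 2) • A (X x₀))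
        + (z t - x₀ - t • v - t ^ 2 • w) + t • A (z t - x₀ - t • v) := by
    simp only [map_sub, map_smul]
    module
  rw [e]
  have hA3 : ‖t • A (z t - x₀ - t • v)‖ ≤ t * (‖A‖ * ((‖w‖ + 1) * t ^ 2)) := by
    rw [norm_smul, Real.norm_of_nonneg htpos.le]
    gcongr
    exact (A.le_opNorm _).trans (by gcongr)
  calc _ ≤ (η * (B * t) + ‖A‖ * ((‖A‖ + 1) * (B * t) * t)) * t + η * t ^ 2
        + t * (‖A‖ * ((‖w‖ + 1) * t ^ 2)) :=
        (norm_add₃_le).trans (add_le_add (add_le_add key htz) hA3)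
    _ = (η * (B + 1) + t * K) * t ^ 2 := by rw [hK]; ring
    _ ≤ (c / 2 + c / 2) * t ^ 2 := by gcongr
    _ = c * t ^ 2 := by ring

/-- A `C¹` vector field has near `x₀` a flow that is continuous and defined for small times. -/
lemma exists_local_flow [CompleteSpace E] {X : E → E} {x₀ : E} (hX : ContDiffAt ℝ 1 X x₀) :
    ∃ r > (0 : ℝ), ∃ ε > (0 : ℝ), ∃ φ : E × ℝ → E,
      ContinuousOn φ (Metric.closedBall x₀ r ×ˢ Icc (-ε) ε) ∧
      ∀ x ∈ Metric.closedBall x₀ r, φ (x, 0) = x ∧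
        ∀ t ∈ Icc (-ε) ε, HasDerivWithinAt (fun s => φ (x, s)) (X (φ (x, t))) (Icc (-ε) ε) t := by
  obtain ⟨ε, hε, a, r, L, K, hr, h⟩ := IsPicardLindelof.of_contDiffAt_one hX
  obtain ⟨φ, h1, h2⟩ :=
    (h 0).exists_forall_mem_closedBall_eq_hasDerivWithinAt_continuousOn
  refine ⟨r, hr, ε, hε, φ, by simpa using h2, fun x hx => ⟨(h1 x hx).1, ?_⟩⟩
  simpa using (h1 x hx).2

end Flow

/-! ### Pieces of trajectories -/

section Arc

variable {n m : ℕ} {f₀ : State n → State n} {f : Fin m → State n → State n}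

/-- `y` is on `[a, b]` a Carathéodory solution with control `α`, with values in `V`. -/
def IsArc (f₀ : State n → State n) (f : Fin m → State n → State n) (V : Set (State n))
    (a b : ℝ) (α : ℝ → Fin m → ℝ) (y : ℝ → State n) : Prop :=
  ContinuousOn y (Icc a b) ∧ ∀ t ∈ Icc a b, y t ∈ V ∧
    IntervalIntegrable (fun s => dynamics f₀ f (y s) (α s)) volume a t ∧
    y t = y a + ∫ s in a..t, dynamics f₀ f (y s) (α s)

/-- `x'` is reached from `x` in time `τ` by a trajectory in `V`. -/
def Reach (f₀ : State n → State n) (f : Fin m → State n → State n) (V : Set (State n))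
    (τ : ℝ) (x x' : State n) : Prop :=
  0 ≤ τ ∧ ∃ (α : ℝ → Fin m → ℝ) (y : ℝ → State n), Measurable α ∧ (∀ t, α t ∈ controlSet m) ∧
    IsArc f₀ f V 0 τ α y ∧ y 0 = x ∧ y τ = x'

lemma IsArc.concat {V : Set (State n)} {a b c : ℝ} {α : ℝ → Fin m → ℝ} {y : ℝ → State n}
    (hab : a ≤ b) (hbc : b ≤ c) (h₁ : IsArc f₀ f V a b α y) (h₂ : IsArc f₀ f V b c α y) :
    IsArc f₀ f V a c α y := by
  refine ⟨?_, fun t ht => ?_⟩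
  · rw [← Icc_union_Icc_eq_Icc hab hbc]
    exact h₁.1.union_of_isClosed h₂.1 isClosed_Icc isClosed_Icc
  · rcases le_total t b with htb | hbt
    · exact h₁.2 t ⟨ht.1, htb⟩
    · obtain ⟨-, i₁, e₁⟩ := h₁.2 b ⟨hab, le_rfl⟩
      obtain ⟨hV, i₂, e₂⟩ := h₂.2 t ⟨hbt, ht.2⟩
      refine ⟨hV, i₁.trans i₂, ?_⟩
      rw [e₂, ← intervalIntegral.integral_add_adjacent_intervals i₁ i₂, ← add_assoc, ← e₁]

/-- The value of the control at the left end point does not affect the integral, so consecutive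
pieces may disagree about the control at their junction. -/
lemma IsArc.congr {V : Set (State n)} {a b : ℝ} {α α' : ℝ → Fin m → ℝ} {y y' : ℝ → State n}
    (h : IsArc f₀ f V a b α y) (hy : EqOn y' y (Icc a b)) (hα : EqOn α' α (Ioc a b)) :
    IsArc f₀ f V a b α' y' := by
  refine ⟨h.1.congr hy, fun t ht => ?_⟩
  obtain ⟨hV, i, e⟩ := h.2 t ht
  have hI : EqOn (fun s => dynamics f₀ f (y' s) (α' s)) (fun s => dynamics f₀ f (y s) (α s))
      (Ioc a t) := fun s hs => by
    have hs' : s ∈ Ioc a b := ⟨hs.1, hs.2.trans ht.2⟩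
    simp only [hy ⟨hs'.1.le, hs'.2⟩, hα hs']
  refine ⟨by rwa [hy ht], ?_, ?_⟩
  · rw [intervalIntegrable_iff_integrableOn_Ioc_of_le ht.1] at i ⊢
    exact i.congr_fun hI.symm measurableSet_Ioc
  · rw [hy ht, hy ⟨le_rfl, ht.1.trans ht.2⟩, e, intervalIntegral.integral_of_le ht.1,
      intervalIntegral.integral_of_le ht.1, setIntegral_congr_fun measurableSet_Ioc hI]

lemma IsArc.shift {V : Set (State n)} {τ : ℝ} {α : ℝ → Fin m → ℝ} {y : ℝ → State n}
    (h : IsArc f₀ f V 0 τ α y) (a : ℝ) :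
    IsArc f₀ f V a (a + τ) (fun t => α (t - a)) (fun t => y (t - a)) := by
  have hmem : ∀ t ∈ Icc a (a + τ), t - a ∈ Icc 0 τ := fun t ht =>
    ⟨by linarith [ht.1], by linarith [ht.2]⟩
  refine ⟨h.1.comp (by fun_prop) hmem, fun t ht => ?_⟩
  obtain ⟨hV, i, e⟩ := h.2 _ (hmem t ht)
  refine ⟨hV, ?_, ?_⟩
  · simpa using i.comp_sub_right a
  · rw [intervalIntegral.integral_comp_sub_right
      (fun s => dynamics f₀ f (y s) (α s)) a, sub_self]
    simpa using e

lemma IsArc.mono {V V' : Set (State n)} {a b : ℝ} {α : ℝ → Fin m → ℝ} {y : ℝ → State n}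
    (h : IsArc f₀ f V a b α y) (hV : V ⊆ V') : IsArc f₀ f V' a b α y :=
  ⟨h.1, fun t ht => ⟨hV (h.2 t ht).1, (h.2 t ht).2⟩⟩

lemma Reach.mono {V V' : Set (State n)} {τ : ℝ} {x x' : State n} (h : Reach f₀ f V τ x x')
    (hV : V ⊆ V') : Reach f₀ f V' τ x x' := by
  obtain ⟨h0, α, y, hα, hA, hy, h⟩ := h
  exact ⟨h0, α, y, hα, hA, hy.mono hV, h⟩

lemma Reach.mem {V : Set (State n)} {τ : ℝ} {x x' : State n} (h : Reach f₀ f V τ x x') :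
    x' ∈ V := by
  obtain ⟨h0, α, y, -, -, hy, -, rfl⟩ := h
  exact (hy.2 τ ⟨h0, le_rfl⟩).1

lemma Reach.refl {V : Set (State n)} {x : State n} (hx : x ∈ V) : Reach f₀ f V 0 x x := by
  refine ⟨le_rfl, 0, fun _ => x, measurable_const, fun _ => Or.inl rfl,
    ⟨continuousOn_const, fun t ht => ?_⟩, rfl, rfl⟩
  obtain rfl : t = 0 := by simpa using ht
  simpa using hx

lemma Reach.trans {V : Set (State n)} {τ₁ τ₂ : ℝ} {x x' x'' : State n}
    (h₁ : Reach f₀ f V τ₁ x x') (h₂ : Reach f₀ f V τ₂ x' x'') :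
    Reach f₀ f V (τ₁ + τ₂) x x'' := by
  obtain ⟨h01, α₁, y₁, hα₁, hA₁, hy₁, rfl, rfl⟩ := h₁
  obtain ⟨h02, α₂, y₂, hα₂, hA₂, hy₂, h0, rfl⟩ := h₂
  refine ⟨by positivity, fun t => if t ≤ τ₁ then α₁ t else α₂ (t - τ₁),
    fun t => if t ≤ τ₁ then y₁ t else y₂ (t - τ₁), ?_, fun t => ?_, ?_, by simp [h01], ?_⟩
  · exact Measurable.ite measurableSet_Iic hα₁ (hα₂.comp (measurable_id.sub_const τ₁))
  · dsimp only
    split_ifs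
    exacts [hA₁ _, hA₂ _]
  · refine IsArc.concat h01 (by linarith) (hy₁.congr (fun t ht => ?_) (fun t ht => ?_))
      ((hy₂.shift τ₁).congr (fun t ht => ?_) (fun t ht => ?_))
    · simp [ht.2]
    · simp [ht.2]
    · rcases ht.1.eq_or_lt with rfl | hlt
      · simp [h0]
      · simp [not_le.2 hlt]
    · simp [not_le.2 ht.1]
  · rcases h02.eq_or_lt with rfl | hlt
    · simp [h0]
    · simp [hlt]

/-- An integral curve of the field of a constant control is an arc. -/
lemma Reach.of_integralCurve {V : Set (State n)} {τ : ℝ} {a : Fin m → ℝ}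
    (ha : a ∈ controlSet m) (hτ : 0 ≤ τ) {y : ℝ → State n}
    (hX : ∀ z ∈ V, ContinuousAt (fun z => dynamics f₀ f z a) z)
    (hy : ∀ t ∈ Icc 0 τ, HasDerivWithinAt y (dynamics f₀ f (y t) a) (Icc 0 τ) t)
    (hV : ∀ t ∈ Icc 0 τ, y t ∈ V) : Reach f₀ f V τ (y 0) (y τ) := by
  have hyc : ContinuousOn y (Icc 0 τ) := fun t ht => (hy t ht).continuousWithinAt
  refine ⟨hτ, fun _ => a, y, measurable_const, fun _ => ha, ⟨hyc, fun t ht => ?_⟩, rfl, rfl⟩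
  have hc : ContinuousOn (fun s => dynamics f₀ f (y s) a) (Icc 0 τ) := fun s hs =>
    (hX _ (hV s hs)).comp_continuousWithinAt (f := y) (hyc s hs)
  have hi : IntervalIntegrable (fun s => dynamics f₀ f (y s) a) volume 0 t :=
    (hc.mono (Icc_subset_Icc_right ht.2)).intervalIntegrable_of_Icc ht.1
  refine ⟨hV t ht, hi, ?_⟩
  rw [intervalIntegral.integral_eq_sub_of_hasDerivAt_of_le ht.1
    (hyc.mono (Icc_subset_Icc_right ht.2)) (fun s hs => ?_) hi]
  · abel
  · exact (hy s ⟨hs.1.le, hs.2.le.trans ht.2⟩).hasDerivAt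
      (Icc_mem_nhds hs.1 (hs.2.trans_le ht.2))

/-! ### Second-order steering by words of constant controls -/

/-- The points near `x₀` can be steered, in any neighborhood of `x₀` and in a time proportional to
a small parameter `t`, to end points that depend continuously on the initial point, in such a way
that the end point for `x₀` is `x₀ + t v + t² w + o(t²)`. -/
def Steers (f₀ : State n → State n) (f : Fin m → State n → State n) (x₀ v w : State n) : Prop :=
  ∃ (Φ : State n → ℝ → State n) (q : ℕ),
    ((fun t : ℝ => Φ x₀ t - x₀ - t • v - t ^ 2 • w) =o[𝓝[>] 0] fun t : ℝ => t ^ 2) ∧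
    (∀ᶠ t in 𝓝[>] (0 : ℝ), ContinuousAt (fun x => Φ x t) x₀) ∧
    ∀ V ∈ 𝓝 x₀, ∀ᶠ p in 𝓝 x₀ ×ˢ 𝓝[>] (0 : ℝ), Reach f₀ f V (q * p.2) p.1 (Φ p.1 p.2)

lemma Steers.zero (x₀ : State n) : Steers f₀ f x₀ 0 0 := by
  refine ⟨fun x _ => x, 0, by simp, by simp [continuousAt_id'], fun V hV => ?_⟩
  have : ∀ᶠ p in 𝓝 x₀ ×ˢ 𝓝[>] (0 : ℝ), p.1 ∈ V := tendsto_fst.eventually hV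
  filter_upwards [this] with p hp
  simpa using Reach.refl hp

/-- Adding one letter to a word: the new end point is the local flow of `X`, run for time `t` from
the old one. Products of derivatives of different letters enter through the term `fderiv ℝ X x₀ v`.
-/
lemma Steers.append {x₀ v w : State n} (h : Steers f₀ f x₀ v w) {a : Fin m → ℝ}
    (ha : a ∈ controlSet m) {X : State n → State n} (hXa : X = fun z => dynamics f₀ f z a)
    (hX : ContDiffAt ℝ 1 X x₀) :
    Steers f₀ f x₀ (v + X x₀)
      (w + fderiv ℝ X x₀ v + (1 / 2 : ℝ) • fderiv ℝ X x₀ (X x₀)) := by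
  obtain ⟨Φ, q, hexp, hcont, hreach⟩ := h
  obtain ⟨r, hr, ε, hε, φ, hφc, hφ⟩ := exists_local_flow hX
  have hcurve : ∀ V ∈ 𝓝 x₀, ∃ W ∈ 𝓝 x₀, ∃ δ > (0 : ℝ), W ⊆ Metric.ball x₀ r ∧ δ ≤ ε ∧
      ∀ u ∈ W, ∀ s ∈ Icc (-δ) δ, φ (u, s) ∈ V := by
    intro V hV
    have hdom : Metric.closedBall x₀ r ×ˢ Icc (-ε) ε ∈ 𝓝 (x₀, (0 : ℝ)) :=
      prod_mem_nhds (Metric.closedBall_mem_nhds _ hr) (Icc_mem_nhds (by linarith) hε)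
    have hca : ContinuousAt φ (x₀, 0) := hφc.continuousAt hdom
    have h0 : φ (x₀, 0) = x₀ := (hφ x₀ (Metric.mem_closedBall_self hr.le)).1
    have hpre : φ ⁻¹' V ∈ 𝓝 (x₀, (0 : ℝ)) := hca (by rwa [h0])
    rw [mem_nhds_prod_iff] at hpre
    obtain ⟨W, hW, I, hI, hWI⟩ := hpre
    obtain ⟨δ, hδ, hδI⟩ := Metric.mem_nhds_iff.1 hI
    refine ⟨W ∩ Metric.ball x₀ r, inter_mem hW (Metric.ball_mem_nhds _ hr), min ε (δ / 2),
      by positivity, inter_subset_right, min_le_left _ _, fun u hu s hs => hWI ⟨hu.1, hδI ?_⟩⟩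
    have h2 : |s| ≤ min ε (δ / 2) := abs_le.2 hs
    rw [Metric.mem_ball, Real.dist_0_eq_abs]
    have := min_le_right ε (δ / 2)
    linarith
  have hpair : Tendsto (fun t : ℝ => (x₀, t)) (𝓝[>] 0) (𝓝 x₀ ×ˢ 𝓝[>] 0) :=
    tendsto_const_nhds.prodMk tendsto_id
  have hΦ : ∀ V ∈ 𝓝 x₀, ∀ᶠ t in 𝓝[>] (0 : ℝ), Φ x₀ t ∈ V := fun V hV =>
    (hpair.eventually (hreach V hV)).mono fun t ht => ht.mem
  have hsmall : ∀ δ > (0 : ℝ), ∀ᶠ t in 𝓝[>] (0 : ℝ), t < δ := fun δ hδ =>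
    nhdsWithin_le_nhds (gt_mem_nhds hδ)
  have hflow : ∀ u ∈ Metric.ball x₀ r, ∀ t, 0 ≤ t → t ≤ ε → ∀ s ∈ Icc 0 t,
      HasDerivWithinAt (fun s => φ (u, s)) (X (φ (u, s))) (Icc 0 t) s := by
    intro u hu t ht0 htε s hs
    exact ((hφ u (Metric.ball_subset_closedBall hu)).2 s
      ⟨by linarith [hs.1], hs.2.trans htε⟩).mono (Icc_subset_Icc (by linarith) htε)
  refine ⟨fun x t => φ (Φ x t, t), q + 1, ?_, ?_, fun V hV => ?_⟩
  · refine isLittleO_flow (y := fun t s => φ (Φ x₀ t, s)) (hX.differentiableAt one_ne_zero)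
      hexp ?_ ?_ fun V hV => ?_
    · filter_upwards [hΦ _ (Metric.ball_mem_nhds x₀ hr)] with t ht
      exact (hφ _ (Metric.ball_subset_closedBall ht)).1
    · filter_upwards [hΦ _ (Metric.ball_mem_nhds x₀ hr), hsmall ε hε, self_mem_nhdsWithin]
        with t ht hte ht0
      exact hflow _ ht t (le_of_lt ht0) hte.le
    · obtain ⟨W, hW, δ, hδ, -, -, h⟩ := hcurve V hV
      filter_upwards [hΦ W hW, hsmall δ hδ] with t ht hte s hs
      exact h _ ht s ⟨by linarith [hs.1], hs.2.trans hte.le⟩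
  · filter_upwards [hcont, hΦ _ (Metric.ball_mem_nhds x₀ hr), hsmall ε hε, self_mem_nhdsWithin]
      with t hct ht hte ht0
    have ht0 : 0 < t := ht0
    have hdom : Metric.closedBall x₀ r ×ˢ Icc (-ε) ε ∈ 𝓝 (Φ x₀ t, t) :=
      prod_mem_nhds (mem_of_superset (Metric.isOpen_ball.mem_nhds ht)
        Metric.ball_subset_closedBall) (Icc_mem_nhds (by linarith) hte)
    exact ContinuousAt.comp (f := fun x => (Φ x t, t)) (hφc.continuousAt hdom)
      (hct.prodMk continuousAt_const)
  · have hXc : ∀ᶠ z in 𝓝 x₀, ContinuousAt X z :=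
      (hX.eventually (by simp)).mono fun z hz => hz.continuousAt
    obtain ⟨W, hW, δ, hδ, hWr, hδε, h⟩ := hcurve _ (inter_mem hV hXc)
    have ht : ∀ᶠ p in 𝓝 x₀ ×ˢ 𝓝[>] (0 : ℝ), p.2 < δ ∧ 0 < p.2 :=
      tendsto_snd.eventually ((hsmall δ hδ).and self_mem_nhdsWithin)
    filter_upwards [hreach _ (inter_mem hV hW), ht] with p hp ⟨hpδ, hp0⟩
    have hW' := hp.mem.2
    have hr2 : Reach f₀ f (V ∩ {z | ContinuousAt X z}) p.2 (φ (Φ p.1 p.2, 0))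
        (φ (Φ p.1 p.2, p.2)) := by
      refine Reach.of_integralCurve (y := fun s => φ (Φ p.1 p.2, s)) ha hp0.le
        (fun z hz => hXa ▸ hz.2) ?_ ?_
      · have := hflow _ (hWr hW') p.2 hp0.le (hpδ.le.trans hδε)
        rw [hXa] at this
        exact this
      · exact fun t ht => h _ hW' t ⟨by linarith [ht.1], ht.2.trans hpδ.le⟩
    rw [(hφ _ (Metric.ball_subset_closedBall (hWr hW'))).1] at hr2
    have := (hp.mono inter_subset_left).trans (hr2.mono inter_subset_left)
    convert this using 1
    push_cast
    ring

end Arc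

/-! ### Steering along the vector fields of the family of degree two -/

section Family

variable {n m : ℕ} {f₀ : State n → State n} {f : Fin m → State n → State n}

lemma dynamics_zero (z : State n) : dynamics f₀ f z 0 = f₀ z := by simp [dynamics]

lemma dynamics_single (z : State n) (i : Fin m) :
    dynamics f₀ f z (Pi.single i 1) = f₀ z + f i z := by
  simp [dynamics, Pi.single_apply, ite_smul]

lemma dynamics_neg_single (z : State n) (i : Fin m) :
    dynamics f₀ f z (-Pi.single i 1) = f₀ z - f i z := by
  simp [dynamics, Pi.single_apply, ite_smul, sub_eq_add_neg]

lemma Steers.drift {x₀ v w : State n} (h : Steers f₀ f x₀ v w) (h₀ : ContDiffAt ℝ 1 f₀ x₀) :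
    ∃ w', Steers f₀ f x₀ (v + f₀ x₀) w' :=
  ⟨_, h.append (Or.inl rfl) (by simp only [dynamics_zero]) h₀⟩

lemma Steers.add {x₀ v w : State n} (h : Steers f₀ f x₀ v w) (h₀ : ContDiffAt ℝ 1 f₀ x₀)
    {i : Fin m} (hi : ContDiffAt ℝ 1 (f i) x₀) :
    Steers f₀ f x₀ (v + (f₀ x₀ + f i x₀))
      (w + (fderiv ℝ f₀ x₀ v + fderiv ℝ (f i) x₀ v) + (1 / 2 : ℝ) •
        (fderiv ℝ f₀ x₀ (f₀ x₀ + f i x₀) + fderiv ℝ (f i) x₀ (f₀ x₀ + f i x₀))) := by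
  have := h.append (Or.inr ⟨i, Or.inl rfl⟩) (by simp only [dynamics_single]) (h₀.add hi)
  rwa [fderiv_fun_add (h₀.differentiableAt one_ne_zero) (hi.differentiableAt one_ne_zero)] at this

lemma Steers.sub {x₀ v w : State n} (h : Steers f₀ f x₀ v w) (h₀ : ContDiffAt ℝ 1 f₀ x₀)
    {i : Fin m} (hi : ContDiffAt ℝ 1 (f i) x₀) :
    Steers f₀ f x₀ (v + (f₀ x₀ - f i x₀))
      (w + (fderiv ℝ f₀ x₀ v - fderiv ℝ (f i) x₀ v) + (1 / 2 : ℝ) •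
        (fderiv ℝ f₀ x₀ (f₀ x₀ - f i x₀) - fderiv ℝ (f i) x₀ (f₀ x₀ - f i x₀))) := by
  have := h.append (Or.inr ⟨i, Or.inr rfl⟩) (by simp only [dynamics_neg_single]) (h₀.sub hi)
  rwa [fderiv_fun_sub (h₀.differentiableAt one_ne_zero) (hi.differentiableAt one_ne_zero)] at this

/-- At a zero of the drift, the word `fᵢ, -fᵢ` moves along `D f₀ · fᵢ`. -/
lemma steers_fderiv_drift {x₀ : State n} (h₀ : ContDiffAt ℝ 1 f₀ x₀) (hz : f₀ x₀ = 0)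
    {i : Fin m} (hi : ContDiffAt ℝ 1 (f i) x₀) :
    Steers f₀ f x₀ 0 (fderiv ℝ f₀ x₀ (f i x₀)) := by
  have := ((Steers.zero x₀).add h₀ hi).sub h₀ hi
  convert this using 1
  · rw [hz]; abel
  · simp only [hz, map_add, map_sub, map_zero]
    module

/-- Exchanging the two letters reverses the sign, so both signs of the drift bracket are available.
-/
lemma steers_neg_fderiv_drift {x₀ : State n} (h₀ : ContDiffAt ℝ 1 f₀ x₀) (hz : f₀ x₀ = 0)
    {i : Fin m} (hi : ContDiffAt ℝ 1 (f i) x₀) :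
    Steers f₀ f x₀ 0 (-fderiv ℝ f₀ x₀ (f i x₀)) := by
  have := ((Steers.zero x₀).sub h₀ hi).add h₀ hi
  convert this using 1
  · rw [hz]; abel
  · simp only [hz, map_add, map_sub, map_zero]
    module

/-- At a zero of the drift, the word `fⱼ, f_ℓ, -fⱼ, -f_ℓ` moves along `[fⱼ, f_ℓ]`, up to a drift
term. -/
lemma steers_lieBracket {x₀ : State n} (h₀ : ContDiffAt ℝ 1 f₀ x₀) (hz : f₀ x₀ = 0)
    {j l : Fin m} (hj : ContDiffAt ℝ 1 (f j) x₀) (hl : ContDiffAt ℝ 1 (f l) x₀) :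
    Steers f₀ f x₀ 0 (VectorField.lieBracket ℝ (f j) (f l) x₀
      + (2 : ℝ) • (fderiv ℝ f₀ x₀ (f j x₀) + fderiv ℝ f₀ x₀ (f l x₀))) := by
  have := ((((Steers.zero x₀).add h₀ hj).add h₀ hl).sub h₀ hj).sub h₀ hl
  convert this using 1
  · rw [hz]; abel
  · simp only [hz, map_add, map_sub, map_zero, VectorField.lieBracket]
    module

/-- A field of the family of degree two along which `p` is negative gives a steering whose leading
term has a negative product with `p`. -/
lemma exists_steers {x₀ p : State n} (h₀ : ContDiffAt ℝ 1 f₀ x₀)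
    (hf : ∀ i, ContDiffAt ℝ 1 (f i) x₀)
    (h : hamiltonianTwo f₀ f x₀ p < 0) :
    ∃ v w, Steers f₀ f x₀ v w ∧ (inner ℝ p v < 0 ∨ v = 0 ∧ inner ℝ p w < 0) := by
  have hne : ((fun g : State n → State n => inner ℝ p (g x₀)) '' familyTwo f₀ f).Nonempty :=
    ⟨_, f₀, Or.inl (Or.inl rfl), rfl⟩
  obtain ⟨_, ⟨g, hg, rfl⟩, hneg⟩ := exists_lt_of_csInf_lt hne h
  dsimp only at hneg
  -- Off the zero set of the drift the truncated bracket vanishes, so its strict negativity forces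
  -- `f₀ x₀ = 0`.
  have hzero : ∀ {Y : State n → State n},
      inner ℝ p (indicator {x | f₀ x = 0} Y x₀) < 0 → f₀ x₀ = 0 ∧ inner ℝ p (Y x₀) < 0 := by
    intro Y hY
    by_cases hx : x₀ ∈ {x | f₀ x = 0}
    · rw [indicator_of_mem hx] at hY
      exact ⟨hx, hY⟩
    · simp [indicator_of_notMem hx] at hY
  have hdrift : f₀ x₀ = 0 → ∀ i, inner ℝ p (fderiv ℝ f₀ x₀ (f i x₀)) ≠ 0 →
      ∃ v w, Steers f₀ f x₀ v w ∧ (inner ℝ p v < 0 ∨ v = 0 ∧ inner ℝ p w < 0) := by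
    intro hz i hi
    rcases lt_or_gt_of_ne hi with hlt | hgt
    · exact ⟨_, _, steers_fderiv_drift h₀ hz (hf i), Or.inr ⟨rfl, hlt⟩⟩
    · refine ⟨_, _, steers_neg_fderiv_drift h₀ hz (hf i), Or.inr ⟨rfl, ?_⟩⟩
      rw [inner_neg_right]
      linarith
  rcases hg with (rfl | ⟨i, rfl | rfl⟩) | ⟨i, rfl | rfl⟩ | ⟨j, l, rfl⟩
  · obtain ⟨w, hw⟩ := (Steers.zero x₀ (f := f)).drift h₀
    exact ⟨_, w, hw, Or.inl (by simpa using hneg)⟩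
  · exact ⟨_, _, (Steers.zero x₀).sub h₀ (hf i), Or.inl (by simpa using hneg)⟩
  · exact ⟨_, _, (Steers.zero x₀).add h₀ (hf i), Or.inl (by simpa using hneg)⟩
  · obtain ⟨hz, hY⟩ := hzero hneg
    -- Where `f₀` vanishes, `[f₀, fᵢ]` reduces to `-Df₀ · fᵢ`; its sign no longer matters, since
    -- `hdrift` serves both.
    refine hdrift hz i fun h0 => ?_
    simp [VectorField.lieBracket, hz, h0] at hY
  · obtain ⟨hz, hY⟩ := hzero hneg
    refine hdrift hz i fun h0 => ?_
    simp [VectorField.lieBracket, hz, h0] at hY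
  · obtain ⟨hz, hY⟩ := hzero hneg
    -- The four-letter word is used only when both parasitic drift terms are orthogonal to `p`;
    -- otherwise one of these terms is itself a direction of decrease, up to sign.
    by_cases hj : inner ℝ p (fderiv ℝ f₀ x₀ (f j x₀)) = 0
    · by_cases hl : inner ℝ p (fderiv ℝ f₀ x₀ (f l x₀)) = 0
      · refine ⟨_, _, steers_lieBracket h₀ hz (hf j) (hf l), Or.inr ⟨rfl, ?_⟩⟩
        rwa [inner_add_right, inner_smul_right, inner_add_right, hj, hl, add_zero, mul_zero,
          add_zero]
      · exact hdrift hz l hl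
    · exact hdrift hz j hj

/-! ### Local decrease of a function with a quadratic upper bound -/

/-- A displacement `σ (u + o(1))` makes the linear term of order `σ` and the quadratic one of order
`σ²`. It is applied with `σ = t` and with `σ = t²`. -/
lemma eventually_inner_add_sq_neg {h : ℝ → State n} {σ : ℝ → ℝ} {p u : State n} (C : ℝ)
    (hσ : Tendsto σ (𝓝[>] 0) (𝓝 0)) (hσ0 : ∀ᶠ t in 𝓝[>] (0 : ℝ), 0 < σ t)
    (hh : Tendsto (fun t => (σ t)⁻¹ • h t) (𝓝[>] 0) (𝓝 u)) (hu : inner ℝ p u < 0) :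
    ∀ᶠ t in 𝓝[>] (0 : ℝ), inner ℝ p (h t) + C * ‖h t‖ ^ 2 < 0 := by
  have hlim : Tendsto (fun t => inner ℝ p ((σ t)⁻¹ • h t) + C * (σ t * ‖(σ t)⁻¹ • h t‖ ^ 2))
      (𝓝[>] 0) (𝓝 (inner ℝ p u + C * (0 * ‖u‖ ^ 2))) :=
    (tendsto_const_nhds.inner hh).add ((hσ.mul (hh.norm.pow 2)).const_mul C)
  simp only [zero_mul, mul_zero, add_zero] at hlim
  filter_upwards [hlim.eventually (gt_mem_nhds hu), hσ0] with t ht h0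
  have e : inner ℝ p (h t) + C * ‖h t‖ ^ 2
      = σ t * (inner ℝ p ((σ t)⁻¹ • h t) + C * (σ t * ‖(σ t)⁻¹ • h t‖ ^ 2)) := by
    rw [inner_smul_right, norm_smul, norm_inv, Real.norm_of_nonneg h0.le]
    field_simp
  rw [e]
  exact mul_neg_of_pos_of_neg h0 ht

/-- A trajectory from `x` in `{U ≤ 2 U(x)}` along which `U` decreases by `δ` in time at most one. -/
def DecreaseStep (f₀ : State n → State n) (f : Fin m → State n → State n) (𝒯 : Set (State n))
    (U : State n → ℝ) (δ : ℝ) (x : State n) (τ : ℝ) (x' : State n) : Prop :=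
  τ ≤ 1 ∧ Reach f₀ f {z | z ∉ 𝒯 ∧ U z ≤ 2 * U x} τ x x' ∧ U x' ≤ U x - δ

lemma DecreaseStep.pos {𝒯 : Set (State n)} {U : State n → ℝ} {δ τ : ℝ} {x x' : State n}
    (h : DecreaseStep f₀ f 𝒯 U δ x τ x') (hδ : 0 < δ) : 0 < τ := by
  obtain ⟨-, ⟨h0, α, y, -, -, -, e0, e1⟩, hU⟩ := h
  refine h0.lt_of_ne fun h => ?_
  subst h
  rw [← e1, e0] at hU
  linarith

/-- The quadratic upper bound is needed at `x₀` only: one `t` with `U (Φ x₀ t) < U x₀` is frozen,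
and continuity of `Φ · t` and `U` carries the drop over to nearby points. -/
lemma exists_local_decrease {𝒯 : Set (State n)} {U : State n → ℝ} {x₀ p v w : State n} {C : ℝ}
    (h𝒯 : IsClosed 𝒯) (hUc : ∀ z ∉ 𝒯, ContinuousAt U z) (hx₀ : x₀ ∉ 𝒯) (hpos : 0 < U x₀)
    (hUp : ∀ᶠ z in 𝓝 x₀, U z ≤ U x₀ + inner ℝ p (z - x₀) + C * ‖z - x₀‖ ^ 2)
    (hS : Steers f₀ f x₀ v w) (hvw : inner ℝ p v < 0 ∨ v = 0 ∧ inner ℝ p w < 0) :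
    ∃ δ > 0, ∀ᶠ x in 𝓝 x₀, ∃ τ x', DecreaseStep f₀ f 𝒯 U δ x τ x' := by
  obtain ⟨Φ, q, hexp, hcont, hreach⟩ := hS
  have hid : Tendsto (fun t : ℝ => t) (𝓝[>] 0) (𝓝 0) := tendsto_id'.2 nhdsWithin_le_nhds
  have hpos' : ∀ᶠ t in 𝓝[>] (0 : ℝ), 0 < t := self_mem_nhdsWithin
  have hres : Tendsto (fun t : ℝ => (t ^ 2)⁻¹ • (Φ x₀ t - x₀ - t • v - t ^ 2 • w)) (𝓝[>] 0)
      (𝓝 0) := by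
    rw [tendsto_zero_iff_norm_tendsto_zero]
    have := hexp.norm_norm.tendsto_div_nhds_zero
    refine this.congr' ?_
    filter_upwards [hpos'] with t ht
    rw [norm_smul, norm_inv, div_eq_inv_mul]
  have hlt : ∀ᶠ t in 𝓝[>] (0 : ℝ), inner ℝ p (Φ x₀ t - x₀) + C * ‖Φ x₀ t - x₀‖ ^ 2 < 0 := by
    rcases hvw with hv | ⟨rfl, hw⟩
    · refine eventually_inner_add_sq_neg C hid hpos' ?_ hv
      have : Tendsto (fun t : ℝ => t • ((t ^ 2)⁻¹ • (Φ x₀ t - x₀ - t • v - t ^ 2 • w)) + v + t • w)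
          (𝓝[>] 0) (𝓝 ((0 : ℝ) • (0 : State n) + v + (0 : ℝ) • w)) :=
        ((hid.smul hres).add_const v).add (hid.smul_const w)
      simp only [smul_zero, zero_smul, zero_add, add_zero] at this
      refine this.congr' ?_
      filter_upwards [hpos'] with t ht
      have h1 : t * (t ^ 2)⁻¹ = t⁻¹ := by field_simp
      have h2 : t⁻¹ * t = 1 := by field_simp
      have h3 : t⁻¹ * t ^ 2 = t := by field_simp
      rw [smul_smul, h1, smul_sub, smul_sub t⁻¹ _ (t • v), smul_smul, smul_smul, h2, h3]
      module
    · refine eventually_inner_add_sq_neg (σ := fun t => t ^ 2) C ?_ ?_ ?_ hw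
      · simpa using hid.pow 2
      · filter_upwards [hpos'] with t ht using by positivity
      · have := hres.add_const w
        rw [zero_add] at this
        refine this.congr' ?_
        filter_upwards [hpos'] with t ht
        have h2 : (t ^ 2)⁻¹ * t ^ 2 = 1 := by field_simp
        rw [smul_zero, sub_zero, smul_sub _ _ (t ^ 2 • w), smul_smul, h2]
        module
  have hV : {z | z ∉ 𝒯 ∧ U z < 4 / 3 * U x₀} ∈ 𝓝 x₀ :=
    inter_mem (h𝒯.isOpen_compl.mem_nhds hx₀) ((hUc x₀ hx₀).eventually (gt_mem_nhds (by linarith)))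
  obtain ⟨P, hP, Q, hQ, hPQ⟩ := eventually_prod_iff.1
    ((hreach _ hV).and (tendsto_snd.eventually
      (show ∀ᶠ t in 𝓝[>] (0 : ℝ), (q : ℝ) * t ≤ 1 by
        have : Tendsto (fun t : ℝ => (q : ℝ) * t) (𝓝[>] 0) (𝓝 ((q : ℝ) * 0)) := hid.const_mul _
        rw [mul_zero] at this
        exact (this.eventually (gt_mem_nhds one_pos)).mono fun t ht => ht.le)))
  have hΦ : Tendsto (fun t : ℝ => Φ x₀ t) (𝓝[>] 0) (𝓝 x₀) := by
    intro V hV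
    exact ((tendsto_const_nhds.prodMk tendsto_id : Tendsto (fun t : ℝ => (x₀, t)) (𝓝[>] 0)
      (𝓝 x₀ ×ˢ 𝓝[>] 0)).eventually (hreach V hV)).mono fun t ht => ht.mem
  obtain ⟨t, hQt, hct, hlt, hUt⟩ := (hQ.and (hcont.and (hlt.and (hΦ.eventually hUp)))).exists
  have hUlt : U (Φ x₀ t) < U x₀ := by linarith
  -- One third of the drop is lost to the variation of the end value, one third to that of the
  -- initial value. Similarly, `4/3 U x₀` is at most `2 U x` once `U x > 2/3 U x₀`.
  set δ := (U x₀ - U (Φ x₀ t)) / 3 with hδ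
  have hδ0 : 0 < δ := by rw [hδ]; linarith
  have hmem := (hPQ hP.self_of_nhds hQt).1.mem
  have hcU : ContinuousAt (fun x => U (Φ x t)) x₀ :=
    ContinuousAt.comp (f := fun x => Φ x t) (hUc _ hmem.1) hct
  refine ⟨δ, hδ0, ?_⟩
  filter_upwards [hP, hcU.eventually (gt_mem_nhds (lt_add_of_pos_right (U (Φ x₀ t)) hδ0)),
    (hUc x₀ hx₀).eventually (lt_mem_nhds (sub_lt_self (U x₀) hδ0)),
    (hUc x₀ hx₀).eventually (lt_mem_nhds (show 2 / 3 * U x₀ < U x₀ by linarith))]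
    with x hx h1 h2 h3
  obtain ⟨hr, hτ⟩ := hPQ hx hQt
  refine ⟨q * t, Φ x t, hτ, hr.mono fun z hz => ⟨hz.1, by linarith [hz.2]⟩, ?_⟩
  have : U x₀ - U (Φ x₀ t) = 3 * δ := by rw [hδ]; ring
  linarith

end Family

/-! ### Limiting gradients of semiconcave functions -/

section Semiconcave

variable {n : ℕ} {F : State n → ℝ} {ρ : ℝ}

/-- Quadratic upper bound of a semiconcave function at a point of differentiability. -/
lemma le_add_inner_gradient {K : Set (State n)} (hK : Convex ℝ K)
    (hsc : ∀ z₁ ∈ K, ∀ z₂ ∈ K, F z₁ + F z₂ - 2 * F (midpoint ℝ z₁ z₂) ≤ ρ * ‖z₁ - z₂‖ ^ 2)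
    {u z : State n} (hu : u ∈ K) (hz : z ∈ K) (hd : DifferentiableAt ℝ F u) :
    F z ≤ F u + inner ℝ (gradient F u) (z - u) + 2 * ρ * ‖z - u‖ ^ 2 := by
  set h := z - u with hh
  set c : ℕ → ℝ := fun k => 2 ^ k with hc
  have hcpos : ∀ k, 0 < c k := fun k => by positivity
  have hmem : ∀ k, u + (c k)⁻¹ • h ∈ K := by
    intro k
    refine hK.add_smul_sub_mem hu hz ⟨by positivity, inv_le_one_of_one_le₀ ?_⟩
    exact one_le_pow₀ one_le_two
  -- The midpoint inequality between `u` and `u + 2⁻ᵏ h` compares consecutive dyadic difference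
  -- quotients. The errors form a geometric series of sum `2 ρ ‖h‖²`, and the quotients tend to the
  -- directional derivative.
  have hstep : ∀ k, c k * (F (u + (c k)⁻¹ • h) - F u)
      ≤ c (k + 1) * (F (u + (c (k + 1))⁻¹ • h) - F u) + ρ * ‖h‖ ^ 2 * (c k)⁻¹ := by
    intro k
    have e : midpoint ℝ u (u + (c k)⁻¹ • h) = u + (c (k + 1))⁻¹ • h := by
      rw [midpoint_eq_smul_add, hc]
      simp only [pow_succ, mul_inv, invOf_eq_inv]
      module
    have := hsc u hu _ (hmem k)
    rw [e, sub_add_cancel_left, norm_neg, norm_smul, norm_inv,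
      Real.norm_of_nonneg (hcpos k).le] at this
    have h2 : c (k + 1) = c k * 2 := pow_succ 2 k
    have h3 := mul_le_mul_of_nonneg_left this (hcpos k).le
    have h4 : c k * (ρ * ((c k)⁻¹ * ‖h‖) ^ 2) = ρ * ‖h‖ ^ 2 * (c k)⁻¹ := by
      have := (hcpos k).ne'
      field_simp
    rw [h4] at h3
    have h5 : ∀ A : ℝ, c (k + 1) * A = c k * 2 * A := fun A => by rw [h2]
    rw [h5]
    linarith
  have hsum : ∀ k, F z - F u ≤ c k * (F (u + (c k)⁻¹ • h) - F u)
      + 2 * (ρ * ‖h‖ ^ 2) * (1 - (c k)⁻¹) := by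
    intro k
    induction k with
    | zero => simp [hc, hh]
    | succ k ih =>
      have := hstep k
      have h2 : (c (k + 1))⁻¹ = (c k)⁻¹ / 2 := by simp only [hc, pow_succ, mul_inv]; ring
      have h3 : 2 * (ρ * ‖h‖ ^ 2) * (1 - (c (k + 1))⁻¹)
          = 2 * (ρ * ‖h‖ ^ 2) * (1 - (c k)⁻¹) + ρ * ‖h‖ ^ 2 * (c k)⁻¹ := by rw [h2]; ring
      linarith
  have hct : Tendsto c atTop atTop := tendsto_pow_atTop_atTop_of_one_lt one_lt_two
  have hlim := hd.hasGradientAt.hasFDerivAt.lim (c := c) h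
    (tendsto_norm_atTop_atTop.comp hct)
  have hlim2 : Tendsto (fun k => 2 * (ρ * ‖h‖ ^ 2) * (1 - (c k)⁻¹)) atTop
      (𝓝 (2 * (ρ * ‖h‖ ^ 2) * (1 - 0))) :=
    (tendsto_const_nhds.sub (tendsto_inv_atTop_zero.comp hct)).const_mul _
  have := ge_of_tendsto' (hlim.add hlim2) hsum
  simp only [InnerProductSpace.toDual_apply_apply, sub_zero, mul_one] at this
  linarith

/-- Points of differentiability of a semiconcave function are dense. -/
lemma exists_differentiableAt_ball {c : State n} {s : ℝ} (hs : 0 < s)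
    (hF : ContinuousOn F (Metric.closedBall c s))
    (hsc : ∀ z₁ ∈ Metric.closedBall c s, ∀ z₂ ∈ Metric.closedBall c s,
      F z₁ + F z₂ - 2 * F (midpoint ℝ z₁ z₂) ≤ ρ * ‖z₁ - z₂‖ ^ 2) :
    ∃ u ∈ Metric.ball c s, DifferentiableAt ℝ F u := by
  have hcmem : c ∈ Metric.closedBall c s := Metric.mem_closedBall_self hs.le
  obtain ⟨zm, -, hzm⟩ := (isCompact_closedBall c s).exists_isMinOn ⟨c, hcmem⟩ hF
  -- This `l` makes the penalized function larger on the sphere than at the center, so its minimum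
  -- `u` is interior. At `u` the minimum supplies a quadratic lower bound and semiconcavity an upper
  -- one, hence differentiability.
  set l := (F c - F zm) / s ^ 2 + 1 with hl
  have hls : l * s ^ 2 = F c - F zm + s ^ 2 := by rw [hl]; field_simp
  have hl0 : 0 ≤ l := by
    have : F zm ≤ F c := hzm hcmem
    have : 0 ≤ F c - F zm := by linarith
    positivity
  obtain ⟨u, hu, hmin⟩ := (isCompact_closedBall c s).exists_isMinOn
    (f := fun z => F z + l * ‖z - c‖ ^ 2) ⟨c, hcmem⟩ (hF.add (by fun_prop))
  have hub : u ∈ Metric.ball c s := by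
    rw [mem_ball_iff_norm]
    refine lt_of_le_of_ne (mem_closedBall_iff_norm.1 hu) fun h => ?_
    have h1 : F u + l * ‖u - c‖ ^ 2 ≤ F c + l * ‖c - c‖ ^ 2 := hmin hcmem
    have h2 : F zm ≤ F u := hzm hu
    rw [h, sub_self, norm_zero, hls] at h1
    nlinarith
  refine ⟨u, hub, ?_⟩
  set g := -((2 * l) • (u - c)) with hg
  obtain ⟨r, hr, hrs⟩ := Metric.isOpen_ball.mem_nhds hub |> Metric.mem_nhds_iff.1
  have hlow : ∀ h : State n, ‖h‖ < r → -(l * ‖h‖ ^ 2) ≤ F (u + h) - F u - inner ℝ g h := by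
    intro h hh
    have hm : u + h ∈ Metric.closedBall c s :=
      Metric.ball_subset_closedBall (hrs (by simpa [mem_ball_iff_norm] using hh))
    have h1 : F u + l * ‖u - c‖ ^ 2 ≤ F (u + h) + l * ‖u + h - c‖ ^ 2 := hmin hm
    have h2 : ‖u + h - c‖ ^ 2 = ‖u - c‖ ^ 2 + 2 * inner ℝ (u - c) h + ‖h‖ ^ 2 := by
      rw [← norm_add_sq_real]
      congr 2
      abel
    rw [hg, inner_neg_left, inner_smul_left]
    simp only [conj_trivial]
    rw [h2] at h1
    nlinarith
  -- Since `u` is the midpoint of `u ± h`, semiconcavity and the lower bound at `-h` bound `F (u +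
  -- h)` from above.
  have hupp : ∀ h : State n, ‖h‖ < r →
      ‖F (u + h) - F u - inner ℝ g h‖ ≤ (4 * |ρ| + l) * ‖h‖ ^ 2 := by
    intro h hh
    have hm1 : u + h ∈ Metric.closedBall c s :=
      Metric.ball_subset_closedBall (hrs (by simpa [mem_ball_iff_norm] using hh))
    have hm2 : u + -h ∈ Metric.closedBall c s :=
      Metric.ball_subset_closedBall (hrs (by simpa [mem_ball_iff_norm] using hh))
    have h1 := hsc _ hm1 _ hm2
    have e1 : midpoint ℝ (u + h) (u + -h) = u := by
      rw [midpoint_eq_smul_add, invOf_eq_inv]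
      module
    have e2 : ‖u + h - (u + -h)‖ = 2 * ‖h‖ := by
      rw [show u + h - (u + -h) = (2 : ℝ) • h by module, norm_smul]
      simp
    rw [e1, e2] at h1
    have h2 := hlow h hh
    have h3 := hlow (-h) (by simpa using hh)
    rw [inner_neg_right, norm_neg] at h3
    have h4 : ρ * (2 * ‖h‖) ^ 2 ≤ 4 * |ρ| * ‖h‖ ^ 2 := by
      have := mul_le_mul_of_nonneg_right (le_abs_self ρ) (sq_nonneg ‖h‖)
      nlinarith
    rw [Real.norm_eq_abs, abs_le]
    have h5 : 0 ≤ |ρ| * ‖h‖ ^ 2 := by positivity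
    constructor <;> nlinarith
  have : HasFDerivAt F (innerSL ℝ g) u := by
    rw [hasFDerivAt_iff_isLittleO_nhds_zero]
    have hO : (fun h : State n => F (u + h) - F u - innerSL ℝ g h)
        =O[𝓝 0] fun h : State n => ‖h‖ ^ 2 := by
      refine Asymptotics.IsBigO.of_bound (4 * |ρ| + l) ?_
      filter_upwards [Metric.ball_mem_nhds (0 : State n) hr] with h hh
      rw [Real.norm_of_nonneg (by positivity : 0 ≤ ‖h‖ ^ 2)]
      exact hupp h (by simpa using hh)
    refine hO.trans_isLittleO ?_
    exact (Asymptotics.isLittleO_norm_pow_id one_lt_two)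
  exact this.differentiableAt

/-- A locally semiconcave function has, at every point of an open set, a limiting gradient that
gives a quadratic upper bound. -/
lemma exists_limitingGradient [Nontrivial (State n)] {Ω : Set (State n)} (hΩ : IsOpen Ω)
    (hF : IsLocallySemiconcaveOn Ω F) {x₀ : State n} (hx₀ : x₀ ∈ Ω) :
    ∃ p ∈ limitingGradients Ω F x₀, ∃ C : ℝ,
      ∀ᶠ z in 𝓝 x₀, F z ≤ F x₀ + inner ℝ p (z - x₀) + C * ‖z - x₀‖ ^ 2 := by
  obtain ⟨R, hR, hRΩ⟩ := Metric.nhds_basis_closedBall.mem_iff.1 (hΩ.mem_nhds hx₀)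
  set K := Metric.closedBall x₀ R with hK
  have hKc : IsCompact K := isCompact_closedBall _ _
  have hKconv : Convex ℝ K := convex_closedBall _ _
  obtain ⟨hcont, ρ, hρ, hsc⟩ := hF K hKc hRΩ
  replace hsc : ∀ z₁ ∈ K, ∀ z₂ ∈ K,
      F z₁ + F z₂ - 2 * F (midpoint ℝ z₁ z₂) ≤ ρ * ‖z₁ - z₂‖ ^ 2 := fun z₁ h₁ z₂ h₂ =>
    hsc z₁ h₁ z₂ h₂ (hKconv.segment_subset h₁ h₂)
  obtain ⟨M, hM⟩ := hKc.exists_bound_of_continuousOn hcont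
  have hpts : ∀ k : ℕ, ∃ u, dist u x₀ < R / 2 / (k + 1) ∧ u ≠ x₀ ∧ DifferentiableAt ℝ F u := by
    intro k
    set d := R / 2 / ((k : ℝ) + 1) / 2 with hd
    have hd0 : 0 < d := by positivity
    have hdR : 2 * d ≤ R / 2 := by
      rw [hd, mul_div_cancel₀ _ two_ne_zero]
      exact div_le_self (by positivity) (by linarith [Nat.cast_nonneg (α := ℝ) k])
    -- The ball of radius `d / 2` is centered at distance `d` from `x₀`, so it misses `x₀`, as
    -- limiting gradients demand.
    obtain ⟨e, he⟩ := exists_norm_eq (State n) hd0.le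
    have hsub : Metric.closedBall (x₀ + e) (d / 2) ⊆ K := by
      intro z hz
      rw [mem_closedBall_iff_norm] at hz
      rw [hK, mem_closedBall_iff_norm]
      calc ‖z - x₀‖ = ‖(z - (x₀ + e)) + e‖ := by congr 1; abel
        _ ≤ d / 2 + d := (norm_add_le _ _).trans (by rw [he]; gcongr)
        _ ≤ R := by linarith
    obtain ⟨u, hu, hdu⟩ := exists_differentiableAt_ball (half_pos hd0) (hcont.mono hsub)
      fun z₁ h₁ z₂ h₂ => hsc z₁ (hsub h₁) z₂ (hsub h₂)
    rw [mem_ball_iff_norm] at hu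
    refine ⟨u, ?_, ?_, hdu⟩
    · rw [dist_eq_norm]
      calc ‖u - x₀‖ = ‖(u - (x₀ + e)) + e‖ := by congr 1; abel
        _ < d / 2 + d := (norm_add_le _ _).trans_lt (by rw [he]; gcongr)
        _ ≤ 2 * d := by linarith
        _ = _ := by rw [hd, mul_div_cancel₀ _ two_ne_zero]
    · rintro rfl
      rw [sub_add_cancel_left, norm_neg, he] at hu
      linarith
  choose u hu hne hdiff using hpts
  have huR : ∀ k, dist (u k) x₀ < R / 2 := fun k =>
    (hu k).trans_le (div_le_self (by positivity) (by linarith [Nat.cast_nonneg (α := ℝ) k]))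
  have huK : ∀ k, u k ∈ K := fun k => by
    rw [hK, Metric.mem_closedBall]; linarith [huR k]
  have hut : Tendsto u atTop (𝓝 x₀) := by
    rw [tendsto_iff_dist_tendsto_zero]
    refine squeeze_zero (fun _ => dist_nonneg) (fun k => (hu k).le) ?_
    exact tendsto_const_nhds.div_atTop
      (tendsto_atTop_add_const_right _ _ tendsto_natCast_atTop_atTop)
  -- Testing the quadratic bound at the point `R / 2` away from `u k` against the gradient bounds
  -- the gradient by the oscillation of `F`.
  have hbd : ∀ k, gradient F (u k) ∈
      Metric.closedBall (0 : State n) ((2 * M + 2 * ρ * (R / 2) ^ 2) / (R / 2)) := by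
    intro k
    set p := gradient F (u k) with hp
    rw [mem_closedBall_zero_iff, le_div_iff₀ (by positivity)]
    have hM0 : 0 ≤ M := (norm_nonneg _).trans (hM _ (huK k))
    rcases eq_or_ne p 0 with h0 | h0
    · rw [h0, norm_zero, zero_mul]; positivity
    have hp0 : 0 < ‖p‖ := norm_pos_iff.2 h0
    set z := u k - (R / 2 / ‖p‖) • p with hz
    have hzu : z - u k = -((R / 2 / ‖p‖) • p) := by rw [hz]; abel
    have hzn : ‖z - u k‖ = R / 2 := by
      rw [hzu, norm_neg, norm_smul, Real.norm_of_nonneg (by positivity)]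
      field_simp
    have hzK : z ∈ K := by
      rw [hK, Metric.mem_closedBall]
      have h1 := dist_triangle z (u k) x₀
      rw [dist_eq_norm z (u k), hzn] at h1
      linarith [huR k]
    have h1 := le_add_inner_gradient hKconv hsc (huK k) hzK (hdiff k)
    rw [hzn, hzu, inner_neg_right, inner_smul_right, ← hp, real_inner_self_eq_norm_sq] at h1
    have h2 : R / 2 / ‖p‖ * ‖p‖ ^ 2 = ‖p‖ * (R / 2) := by field_simp
    have h3 := abs_le.1 (hM _ (huK k))
    have h4 := abs_le.1 (hM _ hzK)
    linarith [h3.1, h3.2, h4.1, h4.2]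
  obtain ⟨p, -, σ, hσ, hp⟩ := (isCompact_closedBall _ _).tendsto_subseq hbd
  have huσ : Tendsto (fun k => u (σ k)) atTop (𝓝 x₀) := hut.comp hσ.tendsto_atTop
  refine ⟨p, ⟨fun k => u (σ k), fun k => ⟨hRΩ (huK _), hne _, hdiff _⟩, huσ, hp⟩, 2 * ρ, ?_⟩
  filter_upwards [Metric.closedBall_mem_nhds x₀ hR] with z hz
  have hFt : Tendsto (fun k => F (u (σ k))) atTop (𝓝 (F x₀)) :=
    (hcont.continuousAt (Metric.closedBall_mem_nhds x₀ hR)).tendsto.comp huσ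
  have hzt : Tendsto (fun k => z - u (σ k)) atTop (𝓝 (z - x₀)) := tendsto_const_nhds.sub huσ
  exact ge_of_tendsto' ((hFt.add (Tendsto.inner hp hzt)).add ((hzt.norm.pow 2).const_mul (2 * ρ)))
    fun k => le_add_inner_gradient hKconv hsc (huK _) hz (hdiff _)

end Semiconcave

/-! ### Majorants of class `𝒦ℒ` -/

section KL

/-- An antitone function with limit `0` has a continuous positive antitone majorant with limit
`0`. -/
lemma exists_continuous_antitone_ge {ν : ℝ → ℝ} (hν : Antitone ν) (h0 : ∀ t, 0 ≤ ν t)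
    (hlim : Tendsto ν atTop (𝓝 0)) :
    ∃ η : ℝ → ℝ, Continuous η ∧ Antitone η ∧ (∀ t, 0 < η t) ∧ Tendsto η atTop (𝓝 0) ∧
      ∀ t, ν t ≤ η t := by
  have hint : ∀ a b, IntervalIntegrable ν volume a b := fun a b => hν.intervalIntegrable
  have hint' : ∀ t, IntervalIntegrable (fun s => ν (t - 1 + s)) volume 0 1 := fun t =>
    (hν.comp_monotone (fun a b hab => by linarith :
      Monotone fun s : ℝ => t - 1 + s)).intervalIntegrable
  have hlow : ∀ t, ν t ≤ ∫ s in (0 : ℝ)..1, ν (t - 1 + s) := fun t => by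
    have := intervalIntegral.integral_mono_on zero_le_one
      (intervalIntegrable_const (c := ν t) (μ := volume)) (hint' t)
      fun s hs => hν (by linarith [hs.2])
    simpa using this
  have hupp : ∀ t, ∫ s in (0 : ℝ)..1, ν (t - 1 + s) ≤ ν (t - 1) := fun t => by
    have := intervalIntegral.integral_mono_on zero_le_one (hint' t)
      (intervalIntegrable_const (c := ν (t - 1)) (μ := volume))
      fun s hs => hν (by linarith [hs.1])
    simpa using this
  -- The mean of `ν` over `[t - 1, t]` lies above `ν t` and is continuous; the exponential makes it
  -- positive.
  refine ⟨fun t => Real.exp (-t) + ∫ s in (0 : ℝ)..1, ν (t - 1 + s), ?_, ?_, fun t => ?_, ?_,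
    fun t => ?_⟩
  · have e : (fun t : ℝ => ∫ s in (0 : ℝ)..1, ν (t - 1 + s))
        = fun t => (∫ s in (0 : ℝ)..t, ν s) - ∫ s in (0 : ℝ)..(t - 1), ν s := by
      funext t
      rw [intervalIntegral.integral_comp_add_left, add_zero, sub_add_cancel,
        intervalIntegral.integral_interval_sub_left (hint _ _) (hint _ _)]
    have hP : Continuous fun t : ℝ => ∫ s in (0 : ℝ)..t, ν s :=
      intervalIntegral.continuous_primitive hint 0
    refine Continuous.add (by fun_prop) ?_
    rw [e]
    exact hP.sub (hP.comp (continuous_id.sub continuous_const))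
  · refine Antitone.add (fun a b hab => Real.exp_le_exp.2 (by linarith)) fun a b hab => ?_
    exact intervalIntegral.integral_mono_on zero_le_one (hint' b) (hint' a)
      fun s hs => hν (by linarith)
  · have := (h0 t).trans (hlow t)
    positivity
  · have h1 : Tendsto (fun t : ℝ => ν (t - 1)) atTop (𝓝 0) :=
      hlim.comp (tendsto_atTop_add_const_right _ (-1) tendsto_id)
    have h2 := Real.tendsto_exp_neg_atTop_nhds_zero.add
      (squeeze_zero (fun t => (h0 t).trans (hlow t)) hupp h1)
    simpa using h2
  · exact (hlow t).trans (by linarith [Real.exp_pos (-t)])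

/-- A monotone function with limit `0` at `0` has a majorant of class `𝒦_∞`. -/
lemma exists_continuous_strictMono_ge {μ : ℝ → ℝ} (hμ : Monotone μ) (h0 : ∀ r, 0 ≤ μ r)
    (hlim : ∀ ε > 0, ∃ r > 0, μ r ≤ ε) :
    ∃ κ : ℝ → ℝ, ContinuousOn κ (Ici 0) ∧ StrictMonoOn κ (Ici 0) ∧ κ 0 = 0 ∧
      ∀ r, 0 ≤ r → r ≤ κ r ∧ μ r ≤ κ r := by
  have hμ0 : μ 0 = 0 := le_antisymm (le_of_forall_pos_le_add fun ε hε => by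
    obtain ⟨r, hr, h⟩ := hlim ε hε
    linarith [hμ hr.le]) (h0 0)
  have hint : ∀ a b, IntervalIntegrable μ volume a b := fun a b => hμ.intervalIntegrable
  have hint' : ∀ r, 0 ≤ r → IntervalIntegrable (fun s => μ (r * s)) volume 1 2 := fun r hr =>
    (hμ.comp (fun a b hab => mul_le_mul_of_nonneg_left hab hr :
      Monotone fun s : ℝ => r * s)).intervalIntegrable
  have hlow : ∀ r, 0 ≤ r → μ r ≤ ∫ s in (1 : ℝ)..2, μ (r * s) := fun r hr => by
    have := intervalIntegral.integral_mono_on one_le_two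
      (intervalIntegrable_const (c := μ r) (μ := volume)) (hint' r hr)
      fun s hs => hμ (le_mul_of_one_le_right hr hs.1)
    rw [intervalIntegral.integral_const] at this
    norm_num at this
    exact this
  have hupp : ∀ r, 0 ≤ r → ∫ s in (1 : ℝ)..2, μ (r * s) ≤ μ (r * 2) := fun r hr => by
    have := intervalIntegral.integral_mono_on one_le_two (hint' r hr)
      (intervalIntegrable_const (c := μ (r * 2)) (μ := volume))
      fun s hs => hμ (by gcongr; exact hs.2)
    rw [intervalIntegral.integral_const] at this
    norm_num at this
    exact this
  have hzero : (∫ s in (1 : ℝ)..2, μ (0 * s)) = 0 := by simp [hμ0]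
  -- The mean of `μ` over `[r, 2r]` is squeezed between `μ r` and `μ (2r)`, hence vanishes at `0`;
  -- adding `r` gives strict growth and unboundedness.
  refine ⟨fun r => r + ∫ s in (1 : ℝ)..2, μ (r * s), ?_, ?_, by simp [hμ0], fun r hr => ?_⟩
  · intro r hr
    refine ContinuousWithinAt.add continuousWithinAt_id ?_
    rcases (mem_Ici.1 hr).eq_or_lt with rfl | hr
    · rw [ContinuousWithinAt, hzero, Metric.tendsto_nhdsWithin_nhds]
      intro ε hε
      obtain ⟨r, hr, h⟩ := hlim (ε / 2) (by positivity)
      refine ⟨r / 2, by positivity, fun s hs hsr => ?_⟩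
      have hs : 0 ≤ s := hs
      rw [Real.dist_0_eq_abs, abs_of_nonneg hs] at hsr
      rw [Real.dist_0_eq_abs, abs_of_nonneg ((h0 s).trans (hlow s hs))]
      calc _ ≤ μ (s * 2) := hupp s hs
        _ ≤ μ r := hμ (by linarith)
        _ < ε := by linarith
    · have hP : Continuous fun t : ℝ => ∫ s in (0 : ℝ)..t, μ s :=
        intervalIntegral.continuous_primitive hint 0
      have hc : ContinuousAt (fun r : ℝ => r⁻¹ *
          ((∫ s in (0 : ℝ)..(r * 2), μ s) - ∫ s in (0 : ℝ)..r, μ s)) r :=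
        (continuousAt_inv₀ hr.ne').mul
          (((hP.comp (continuous_id.mul continuous_const)).sub hP).continuousAt)
      refine (hc.congr ?_).continuousWithinAt
      filter_upwards [lt_mem_nhds hr] with s hs
      rw [intervalIntegral.integral_comp_mul_left _ hs.ne', mul_one,
        intervalIntegral.integral_interval_sub_left (hint _ _) (hint _ _), smul_eq_mul]
  · intro a ha b hb hab
    refine add_lt_add_of_lt_of_le hab ?_
    exact intervalIntegral.integral_mono_on one_le_two (hint' a ha) (hint' b hb)
      fun s hs => hμ (mul_le_mul_of_nonneg_right hab.le (by linarith [hs.1]))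
  · have := hlow r hr
    constructor <;> linarith [h0 r]

/-- Countably many antitone functions with limit `0` are dominated, up to constants, by a single
one. -/
lemma exists_antitone_dominating {φ : ℕ → ℝ → ℝ} (hφ : ∀ k, Antitone (φ k))
    (h0 : ∀ k t, 0 ≤ φ k t) (hle : ∀ k t, φ k t ≤ φ k 0)
    (hlim : ∀ k, Tendsto (φ k) atTop (𝓝 0)) :
    ∃ ν : ℝ → ℝ, Antitone ν ∧ (∀ t, 0 ≤ ν t) ∧ Tendsto ν atTop (𝓝 0) ∧
      ∀ k t, φ k t ≤ 2 ^ k * (1 + φ k 0) * ν t := by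
  -- The normalized functions are dominated by `2⁻ᵏ` uniformly in `t`, so their sum still tends to
  -- `0`.
  set g : ℕ → ℝ → ℝ := fun k t => (1 / 2) ^ k * (φ k t / (1 + φ k 0)) with hg
  have hden : ∀ k, 0 < 1 + φ k 0 := fun k => by linarith [h0 k 0]
  have hg0 : ∀ k t, 0 ≤ g k t := fun k t =>
    mul_nonneg (by positivity) (div_nonneg (h0 k t) (hden k).le)
  have hg1 : ∀ k t, g k t ≤ (1 / 2) ^ k := fun k t => by
    refine mul_le_of_le_one_right (by positivity) ?_
    rw [div_le_one (hden k)]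
    linarith [hle k t]
  have hsum : ∀ t, Summable fun k => g k t := fun t =>
    Summable.of_nonneg_of_le (fun k => hg0 k t) (fun k => hg1 k t) summable_geometric_two
  refine ⟨fun t => ∑' k, g k t, fun a b hab => ?_, fun t => tsum_nonneg fun k => hg0 k t, ?_,
    fun k t => ?_⟩
  · refine (hsum b).tsum_le_tsum (fun k => ?_) (hsum a)
    have := hden k
    have := hφ k hab
    simp only [hg]
    gcongr
  · have := tendsto_tsum_of_dominated_convergence (f := fun t k => g k t) (g := fun _ => (0 : ℝ))
      (𝓕 := atTop) summable_geometric_two (fun k => ?_) (Eventually.of_forall fun t k => ?_)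
    · simpa using this
    · have := ((hlim k).div_const (1 + φ k 0)).const_mul ((1 / 2) ^ k)
      rwa [zero_div, mul_zero] at this
    · rw [Real.norm_of_nonneg (hg0 k t)]
      exact hg1 k t
  · have h1 : g k t ≤ ∑' k, g k t := (hsum t).le_tsum k fun j _ => hg0 j t
    have h2 : φ k t = 2 ^ k * (1 + φ k 0) * g k t := by
      have := hden k
      simp only [hg, one_div, inv_pow]
      field_simp
    rw [h2]
    have := hden k
    gcongr

/-- A function that is monotone in the first variable, antitone with limit `0` in the second one
and small for small values of the first variable has a majorant of class `𝒦ℒ`. -/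
lemma exists_isKL_ge {ψ : ℝ → ℝ → ℝ} (h0 : ∀ r t, 0 ≤ ψ r t)
    (hmono : ∀ t, Monotone fun r => ψ r t) (hanti : ∀ r, Antitone (ψ r))
    (hle : ∀ r t, ψ r t ≤ ψ r 0) (hlim : ∀ r, Tendsto (ψ r) atTop (𝓝 0))
    (hsmall : ∀ ε > 0, ∃ r > 0, ψ r 0 ≤ ε) :
    ∃ β : ℝ → ℝ → ℝ, IsKL β ∧ ∀ r t, 0 ≤ r → ψ r t ≤ β r t := by
  obtain ⟨ν, hν, hν0, hνlim, hνle⟩ := exists_antitone_dominating (φ := fun k => ψ k)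
    (fun k => hanti k) (fun k => h0 k) (fun k => hle k) fun k => hlim k
  set C : ℕ → ℝ := fun k => 2 ^ k * (1 + ψ k 0) with hC
  have hC0 : ∀ k, 0 < C k := fun k => by have := h0 k 0; positivity
  have hCm : Monotone C := fun a b hab => by
    have h1 : ψ a 0 ≤ ψ b 0 := hmono 0 (Nat.cast_le.2 hab)
    have := h0 a 0
    simp only [hC]
    gcongr
    exact one_le_two
  -- From `ψ r t ≤ ψ r 0` and `ψ r t ≤ C ⌈r⌉₊ * ν t`, the geometric mean gives a product bound `μ r
  -- * √(ν t)`, small both for small `r` and for large `t`.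
  set μ : ℝ → ℝ := fun r => √(ψ r 0 * C ⌈r⌉₊) with hμ
  have hμm : Monotone μ := fun a b hab => by
    refine Real.sqrt_le_sqrt (mul_le_mul (hmono 0 hab) (hCm (Nat.ceil_mono hab)) (hC0 _).le
      (h0 _ _))
  obtain ⟨κ, hκc, hκm, hκ0, hκ⟩ := exists_continuous_strictMono_ge hμm
    (fun r => Real.sqrt_nonneg _) fun ε hε => by
      obtain ⟨r, hr, h⟩ := hsmall (ε ^ 2 / C 1) (by have := hC0 1; positivity)
      refine ⟨min r 1, by positivity, Real.sqrt_le_iff.2 ⟨hε.le, ?_⟩⟩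
      have h1 : ψ (min r 1) 0 ≤ ε ^ 2 / C 1 := (hmono 0 (min_le_left r 1)).trans h
      have h2 : C ⌈min r 1⌉₊ ≤ C 1 := hCm (by
        rw [Nat.ceil_le, Nat.cast_one]; exact min_le_right _ _)
      calc _ ≤ ε ^ 2 / C 1 * C 1 := mul_le_mul h1 h2 (hC0 _).le ((h0 _ _).trans h1)
        _ = ε ^ 2 := div_mul_cancel₀ _ (hC0 1).ne'
  obtain ⟨η, hηc, hηm, hη0, hηlim, hη⟩ := exists_continuous_antitone_ge (ν := fun t => √(ν t))
    (fun a b hab => Real.sqrt_le_sqrt (hν hab)) (fun t => Real.sqrt_nonneg _)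
    (by
      have := (Real.continuous_sqrt.tendsto 0).comp hνlim
      rwa [Real.sqrt_zero] at this)
  have hκn : ∀ r, 0 ≤ r → 0 ≤ κ r := fun r hr => hr.trans (hκ r hr).1
  refine ⟨fun r t => κ r * η t, ⟨?_, ?_, ?_, ?_, ?_, ?_, ?_⟩, fun r t hr => ?_⟩
  · exact (hκc.comp continuousOn_fst fun q hq => hq.1).mul
      (hηc.comp continuous_snd).continuousOn
  · exact fun δ s hδ _ => mul_nonneg (hκn δ hδ) (hη0 s).le
  · exact fun s _ => by rw [hκ0, zero_mul]
  · exact fun s _ a ha b hb hab => mul_lt_mul_of_pos_right (hκm ha hb hab) (hη0 s)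
  · rintro s - ⟨M, hM⟩
    have hpos : 0 ≤ (|M| + 1) / η s := div_nonneg (by positivity) (hη0 s).le
    have h1 : κ ((|M| + 1) / η s) * η s ≤ M := hM ⟨_, hpos, rfl⟩
    have h2 : (|M| + 1) / η s * η s ≤ κ ((|M| + 1) / η s) * η s :=
      mul_le_mul_of_nonneg_right (hκ _ hpos).1 (hη0 s).le
    rw [div_mul_cancel₀ _ (hη0 s).ne'] at h2
    linarith [le_abs_self M]
  · exact fun δ hδ a _ b _ hab => mul_le_mul_of_nonneg_left (hηm hab) (hκn δ hδ)
  · intro δ _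
    simpa using hηlim.const_mul (κ δ)
  · have h1 : ψ r t ≤ C ⌈r⌉₊ * ν t := (hmono t (Nat.le_ceil r)).trans (hνle _ t)
    have h2 : ψ r t ≤ μ r * √(ν t) := by
      rw [hμ, ← Real.sqrt_mul (mul_nonneg (h0 _ _) (hC0 _).le)]
      refine Real.le_sqrt_of_sq_le ?_
      rw [sq, mul_assoc]
      exact mul_le_mul (hle r t) h1 (h0 r t) (h0 r 0)
    exact h2.trans (mul_le_mul (hκ r hr).2 (hη t) (Real.sqrt_nonneg _) (hκn r hr))

/-- Uniform stability and attractivity of a family of functions give a bound of class `𝒦ℒ`. -/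
lemma exists_isKL_bound {ι : Type*} {d : ι → ℝ} {D : ι → ℝ → ℝ} (hd : ∀ x, 0 ≤ d x)
    (hstable : ∀ ε > 0, ∃ r > 0, ∀ x, d x ≤ r → ∀ t, 0 ≤ t → D x t ≤ ε)
    (hbdd : ∀ R, ∃ M, ∀ x, d x ≤ R → ∀ t, 0 ≤ t → D x t ≤ M)
    (hattr : ∀ R, ∀ ε > 0, ∃ N, ∀ x, d x ≤ R → ∀ t, 0 ≤ t → N ≤ t → D x t ≤ ε) :
    ∃ β : ℝ → ℝ → ℝ, IsKL β ∧ ∀ x t, 0 ≤ t → D x t ≤ β (d x) t := by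
  set S : ℝ → ℝ → Set ℝ := fun r t =>
    insert 0 {v | ∃ x s, d x ≤ r ∧ 0 ≤ s ∧ t ≤ s ∧ v = D x s} with hS
  have hSb : ∀ r t, BddAbove (S r t) := fun r t => by
    obtain ⟨M, hM⟩ := hbdd r
    refine BddAbove.insert 0 ⟨M, ?_⟩
    rintro _ ⟨x, s, hx, hs, -, rfl⟩
    exact hM x hx s hs
  have hSne : ∀ r t, (S r t).Nonempty := fun r t => ⟨0, Or.inl rfl⟩
  have hSle : ∀ r t c, 0 ≤ c → (∀ x s, d x ≤ r → 0 ≤ s → t ≤ s → D x s ≤ c) →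
      sSup (S r t) ≤ c := fun r t c hc h => by
    refine csSup_le (hSne r t) ?_
    rintro _ (rfl | ⟨x, s, hx, hs, hts, rfl⟩)
    exacts [hc, h x s hx hs hts]
  have hge : ∀ r t x s, d x ≤ r → 0 ≤ s → t ≤ s → D x s ≤ sSup (S r t) := fun r t x s hx hs hts =>
    le_csSup (hSb r t) (Or.inr ⟨x, s, hx, hs, hts, rfl⟩)
  have h0 : ∀ r t, 0 ≤ sSup (S r t) := fun r t => le_csSup (hSb r t) (Or.inl rfl)
  obtain ⟨β, hβ, h⟩ := exists_isKL_ge (ψ := fun r t => sSup (S r t)) h0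
    (fun t a b hab => hSle a t _ (h0 _ _) fun x s hx hs hts => hge b t x s (hx.trans hab) hs hts)
    (fun r a b hab => hSle r b _ (h0 _ _) fun x s hx hs hts => hge r a x s hx hs (hab.trans hts))
    (fun r t => hSle r t _ (h0 _ _) fun x s hx hs _ => hge r 0 x s hx hs hs)
    (fun r => by
      rw [Metric.tendsto_atTop]
      intro ε hε
      obtain ⟨N, hN⟩ := hattr r (ε / 2) (by positivity)
      refine ⟨N, fun t ht => ?_⟩
      rw [Real.dist_0_eq_abs, abs_of_nonneg (h0 r t)]
      refine (hSle r t (ε / 2) (by positivity) fun x s hx hs hts =>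
        hN x hx s hs (ht.trans hts)).trans_lt (by linarith))
    (fun ε hε => by
      obtain ⟨r, hr, h⟩ := hstable ε hε
      exact ⟨r, hr, hSle r 0 ε hε.le fun x s hx hs _ => h x hx s hs⟩)
  exact ⟨β, hβ, fun x t ht => (hge _ t x t le_rfl ht le_rfl).trans (h _ t (hd x))⟩

end KL

/-! ### Concatenation of infinitely many pieces of trajectories -/

section Concatenation

variable {n m : ℕ} {f₀ : State n → State n} {f : Fin m → State n → State n}

/-- Infinitely many pieces of trajectories, each issuing from the end point of the previous one,
form a trajectory on `[0, T)`, where `T` is the sum of their durations; it is prolonged by `z`. -/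
lemma exists_concatenation {V : ℕ → Set (State n)} {x : ℕ → State n} {τ : ℕ → ℝ}
    (hτ : ∀ k, 0 < τ k) (hr : ∀ k, Reach f₀ f (V k) (τ k) (x k) (x (k + 1))) (z : State n) :
    ∃ (T : EReal) (y : ℝ → State n) (α : ℝ → Fin m → ℝ),
      Measurable α ∧ (∀ t, α t ∈ controlSet m) ∧ y 0 = x 0 ∧
      (∀ k, ((∑ i ∈ Finset.range k, τ i : ℝ) : EReal) < T) ∧
      (∀ t : ℝ, (t : EReal) < T → ∃ k, t < ∑ i ∈ Finset.range k, τ i) ∧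
      (∀ k, IsArc f₀ f (⋃ j, V j) 0 (∑ i ∈ Finset.range k, τ i) α y) ∧
      (∀ t : ℝ, T ≤ (t : EReal) → y t = z) ∧
      ∀ k, ∀ t ∈ Icc (∑ i ∈ Finset.range k, τ i) (∑ i ∈ Finset.range (k + 1), τ i),
        y t ∈ V k := by
  classical
  choose hτ0 α y hαm hαA harc hy0 hyτ using hr
  set s : ℕ → ℝ := fun k => ∑ i ∈ Finset.range k, τ i with hs
  have hs1 : ∀ k, s (k + 1) = s k + τ k := fun k => Finset.sum_range_succ _ _
  have hs0 : s 0 = 0 := by simp [hs]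
  have hsm : StrictMono s := strictMono_nat_of_lt_succ fun k => by
    rw [hs1]; linarith [hτ k]
  -- The second alternative makes the index of the current piece defined beyond all the `s j` too.
  -- There it is `0`, and the default values `0` and `z` below take over.
  set P : ℕ → ℝ → Prop := fun k t => t ≤ s (k + 1) ∨ ∀ j, s j ≤ t with hP
  have hex : ∀ t, ∃ k, P k t := fun t => by
    by_cases h : ∀ j, s j ≤ t
    · exact ⟨0, Or.inr h⟩
    · push Not at h
      obtain ⟨j, hj⟩ := h
      exact ⟨j, Or.inl (hj.le.trans (hsm j.lt_succ_self).le)⟩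
  have hfind : ∀ k, ∀ t ∈ Ioc (s k) (s (k + 1)), Nat.find (hex t) = k := fun k t ht => by
    rw [Nat.find_eq_iff]
    refine ⟨Or.inl ht.2, fun j hj => ?_⟩
    rintro (h | h)
    · exact absurd (h.trans (hsm.monotone hj)) (not_le.2 ht.1)
    · exact absurd ((h (k + 2)).trans ht.2) (not_le.2 (hsm (by omega)))
  have hfind0 : Nat.find (hex 0) = 0 := by
    rw [Nat.find_eq_zero]
    exact Or.inl (hs0 ▸ hsm.monotone (Nat.zero_le _))
  set F : ℕ → ℝ → Fin m → ℝ := fun k t => if t ≤ s (k + 1) then α k (t - s k) else 0 with hF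
  set G : ℕ → ℝ → State n := fun k t => if t ≤ s (k + 1) then y k (t - s k) else z with hG
  have hα : ∀ k, EqOn (fun t => F (Nat.find (hex t)) t) (fun t => α k (t - s k))
      (Ioc (s k) (s (k + 1))) := fun k t ht => by
    simp only [hfind k t ht, hF, if_pos ht.2]
  have hy' : ∀ k, EqOn (fun t => G (Nat.find (hex t)) t) (fun t => y k (t - s k))
      (Ioc (s k) (s (k + 1))) := fun k t ht => by
    simp only [hfind k t ht, hG, if_pos ht.2]
  have hy0' : G (Nat.find (hex 0)) 0 = x 0 := by
    have : (0 : ℝ) ≤ s (0 + 1) := hs0 ▸ hsm.monotone (Nat.zero_le _)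
    rw [hfind0]
    simp only [hG, if_pos this, hs0, sub_zero, hy0]
  have hsx : ∀ k, G (Nat.find (hex (s k))) (s k) = x k := fun k => by
    cases k with
    | zero => rw [hs0, hy0']
    | succ k =>
      refine (hy' k ⟨hsm k.lt_succ_self, le_rfl⟩).trans ?_
      dsimp only
      rw [hs1, add_sub_cancel_left, hyτ]
  have hy : ∀ k, EqOn (fun t => G (Nat.find (hex t)) t) (fun t => y k (t - s k))
      (Icc (s k) (s (k + 1))) := fun k t ht => by
    rcases ht.1.eq_or_lt with rfl | hlt
    · dsimp only
      rw [hsx, sub_self, hy0]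
    · exact hy' k ⟨hlt, ht.2⟩
  have hpiece : ∀ k, IsArc f₀ f (V k) (s k) (s (k + 1)) (fun t => F (Nat.find (hex t)) t)
      (fun t => G (Nat.find (hex t)) t) := fun k => by
    have := (harc k).shift (s k)
    rw [← hs1] at this
    exact this.congr (hy k) (hα k)
  refine ⟨⨆ k, (s k : EReal), fun t => G (Nat.find (hex t)) t, fun t => F (Nat.find (hex t)) t,
    ?_, fun t => ?_, hy0', fun k => ?_, fun t ht => ?_, fun k => ?_, fun t ht => ?_,
    fun k t ht => ((hpiece k).2 t ht).1⟩
  · refine Measurable.find (p := P) (fun k => ?_) (fun k => ?_) hex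
    · exact Measurable.ite measurableSet_Iic ((hαm k).comp (measurable_id.sub_const _))
        measurable_const
    · have e : {t | P k t} = Iic (s (k + 1)) ∪ ⋂ j, Ici (s j) := by ext t; simp [hP]
      rw [e]
      exact measurableSet_Iic.union (MeasurableSet.iInter fun j => measurableSet_Ici)
  · simp only [hF]
    split_ifs
    exacts [hαA _ _, Or.inl rfl]
  · exact lt_of_lt_of_le (EReal.coe_lt_coe_iff.2 (hsm k.lt_succ_self))
      (le_iSup (fun k => (s k : EReal)) (k + 1))
  · obtain ⟨k, hk⟩ := lt_iSup_iff.1 ht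
    exact ⟨k, EReal.coe_lt_coe_iff.1 hk⟩
  · induction k with
    | zero =>
      change IsArc f₀ f _ 0 (s 0) _ _
      rw [hs0]
      have := ((hpiece 0).mono (subset_iUnion V 0))
      rw [hs0] at this
      refine ⟨this.1.mono (Icc_subset_Icc_right ?_), fun t ht => this.2 t ⟨ht.1, ht.2.trans ?_⟩⟩
      all_goals exact hs0 ▸ hsm.monotone (Nat.zero_le _)
    | succ k ih =>
      exact ih.concat (hs0 ▸ hsm.monotone (Nat.zero_le k)) (hsm k.lt_succ_self).le
        ((hpiece k).mono (subset_iUnion V k))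
  · have h : ∀ j, s j ≤ t := fun j => EReal.coe_le_coe_iff.1 ((le_iSup _ j).trans ht)
    have h0 : ¬ t ≤ s (Nat.find (hex t) + 1) := fun h' =>
      absurd ((h _).trans h') (not_le.2 (hsm (Nat.lt_succ_self _)))
    simp only [hG, if_neg h0]

end Concatenation

/-! ### Uniform decrease along selected steps -/

section Selection

variable {n m : ℕ} {f₀ : State n → State n} {f : Fin m → State n → State n}
  {𝒯 : Set (State n)} {U : State n → ℝ}

lemma DecreaseStep.anti {δ δ' : ℝ} {x x' : State n} {τ : ℝ}
    (h : DecreaseStep f₀ f 𝒯 U δ x τ x') (hδ : δ' ≤ δ) : DecreaseStep f₀ f 𝒯 U δ' x τ x' :=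
  ⟨h.1, h.2.1, h.2.2.trans (by linarith)⟩

lemma contDiffAt_of_isCOneBounded (h𝒯 : IsClosed 𝒯) {g : State n → State n}
    (hg : ∀ Ω : Set (State n), IsOpen Ω → Bornology.IsBounded Ω → IsCOneBounded (Ω \ 𝒯) g)
    {x : State n} (hx : x ∉ 𝒯) : ContDiffAt ℝ 1 g x :=
  (hg (Metric.ball x 1) Metric.isOpen_ball Metric.isBounded_ball).1.contDiffAt
    (inter_mem (Metric.ball_mem_nhds x one_pos) (h𝒯.isOpen_compl.mem_nhds hx))

lemma IsDegreeTwoCLF.continuousAt (hU : IsDegreeTwoCLF f₀ f 𝒯 U) (h𝒯 : IsClosed 𝒯)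
    {x : State n} (hx : x ∉ 𝒯) : ContinuousAt U x :=
  hU.continuousOn.continuousAt
    (mem_of_superset (h𝒯.isOpen_compl.mem_nhds hx) subset_closure)

lemma IsDegreeTwoCLF.exists_local_decrease (hU : IsDegreeTwoCLF f₀ f 𝒯 U) (h𝒯 : IsClosed 𝒯)
    (hne : 𝒯.Nonempty) {x : State n} (h₀ : ContDiffAt ℝ 1 f₀ x)
    (hf : ∀ i, ContDiffAt ℝ 1 (f i) x) (hx : x ∉ 𝒯) :
    ∃ δ > 0, ∀ᶠ x₁ in 𝓝 x, ∃ τ x', DecreaseStep f₀ f 𝒯 U δ x₁ τ x' := by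
  obtain ⟨t, ht⟩ := hne
  have : Nontrivial (State n) := ⟨⟨x, t, fun h => hx (h ▸ ht)⟩⟩
  obtain ⟨p, hp, C, hC⟩ := exists_limitingGradient h𝒯.isOpen_compl hU.semiconcave hx
  obtain ⟨v, w, hS, hvw⟩ := exists_steers h₀ hf (hU.decrease x hx p hp)
  exact DriftCLF.exists_local_decrease h𝒯 (fun z hz => hU.continuousAt h𝒯 hz) hx (hU.pos x hx)
    hC hS hvw

/-- The band `a ≤ U ≤ b` is compact by properness and, as `a > 0`, stays off `∂𝒯`; finitely many
local drops cover it. -/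
lemma IsDegreeTwoCLF.exists_uniform_decrease (hU : IsDegreeTwoCLF f₀ f 𝒯 U) (h𝒯 : IsClosed 𝒯)
    (hne : 𝒯.Nonempty) (h₀ : ∀ x ∉ 𝒯, ContDiffAt ℝ 1 f₀ x)
    (hf : ∀ i, ∀ x ∉ 𝒯, ContDiffAt ℝ 1 (f i) x) {a : ℝ} (ha : 0 < a) (b : ℝ) :
    ∃ δ > 0, ∀ x ∉ 𝒯, a ≤ U x → U x ≤ b → ∃ τ x', DecreaseStep f₀ f 𝒯 U δ x τ x' := by
  have hK := hU.proper (Icc a b) isCompact_Icc fun u hu => ha.le.trans hu.1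
  obtain ⟨δ, hδ, h⟩ := hK.induction_on
    (p := fun S => ∃ δ > 0, ∀ x ∈ S, ∃ τ x', DecreaseStep f₀ f 𝒯 U δ x τ x')
    ⟨1, one_pos, by simp⟩
    (fun S S' hSS' ⟨δ, hδ, h⟩ => ⟨δ, hδ, fun x hx => h x (hSS' hx)⟩)
    (fun S S' ⟨δ, hδ, h⟩ ⟨δ', hδ', h'⟩ => ⟨min δ δ', lt_min hδ hδ', fun x hx => by
      rcases hx with hx | hx
      · obtain ⟨τ, x', h⟩ := h x hx
        exact ⟨τ, x', h.anti (min_le_left _ _)⟩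
      · obtain ⟨τ, x', h⟩ := h' x hx
        exact ⟨τ, x', h.anti (min_le_right _ _)⟩⟩)
    (fun x hx => by
      have hxT : x ∉ 𝒯 := fun h => by
        have h0 := hU.zero_frontier x (by
          rw [frontier_eq_closure_inter_closure]; exact ⟨subset_closure h, hx.1⟩)
        have := hx.2.1
        linarith
      obtain ⟨δ, hδ, h⟩ := hU.exists_local_decrease h𝒯 hne (h₀ x hxT) (fun i => hf i x hxT) hxT
      exact ⟨_, mem_nhdsWithin_of_mem_nhds h, δ, hδ, fun x₁ hx₁ => hx₁⟩)
  exact ⟨δ, hδ, fun x hx hax hxb => h x ⟨subset_closure hx, hax, hxb⟩⟩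

/-- A selection of decreasing steps, with a decrease that is bounded below on every sublevel set
away from the target. -/
lemma IsDegreeTwoCLF.exists_selection (hU : IsDegreeTwoCLF f₀ f 𝒯 U) (h𝒯 : IsClosed 𝒯)
    (hne : 𝒯.Nonempty) (h₀ : ∀ x ∉ 𝒯, ContDiffAt ℝ 1 f₀ x)
    (hf : ∀ i, ∀ x ∉ 𝒯, ContDiffAt ℝ 1 (f i) x) :
    ∃ (next : {x // x ∉ 𝒯} → {x // x ∉ 𝒯}) (τ δ : {x // x ∉ 𝒯} → ℝ),
      (∀ x, 0 < δ x ∧ DecreaseStep f₀ f 𝒯 U (δ x) x (τ x) (next x)) ∧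
      ∀ a > 0, ∀ b, ∃ c > 0, ∀ x : {x // x ∉ 𝒯}, a ≤ U x → U x ≤ b → c ≤ δ x := by
  classical
  have hunif := fun (a : ℝ) (ha : 0 < a) (b : ℝ) =>
    hU.exists_uniform_decrease h𝒯 hne h₀ hf ha b
  have hstep : ∀ a > 0, ∀ b, ∃ k : ℕ, ∀ x : {x // x ∉ 𝒯}, a ≤ U x → U x ≤ b →
      ∃ τ x', DecreaseStep f₀ f 𝒯 U (1 / ((k : ℝ) + 1)) x τ x' := by
    intro a ha b
    obtain ⟨δ, hδ, h⟩ := hunif a ha b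
    obtain ⟨k, hk⟩ := exists_nat_one_div_lt hδ
    refine ⟨k, fun x hax hxb => ?_⟩
    obtain ⟨τ, x', h⟩ := h x x.2 hax hxb
    exact ⟨τ, x', h.anti hk.le⟩
  have hex : ∀ x : {x // x ∉ 𝒯}, ∃ k : ℕ, ∃ τ x',
      DecreaseStep f₀ f 𝒯 U (1 / ((k : ℝ) + 1)) x τ x' := fun x => by
    obtain ⟨k, h⟩ := hstep (U x) (hU.pos x x.2) (U x)
    exact ⟨k, h x le_rfl le_rfl⟩
  -- Taking the least `k` makes the drop nearly the best possible at `x`, so one selection inherits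
  -- the uniform bounds of all the bands at once.
  choose τ next h using fun x => Nat.find_spec (hex x)
  refine ⟨fun x => ⟨next x, (h x).2.1.mem.1⟩, τ, fun x => 1 / ((Nat.find (hex x) : ℝ) + 1),
    fun x => ⟨by positivity, h x⟩, fun a ha b => ?_⟩
  obtain ⟨k, hk⟩ := hstep a ha b
  refine ⟨1 / ((k : ℝ) + 1), by positivity, fun x hax hxb => ?_⟩
  exact one_div_le_one_div_of_le (by positivity)
    (add_le_add_left (Nat.cast_le.2 (Nat.find_min' _ (hk x hax hxb))) 1)

/-- The number of selected steps that lead from `{U ≤ b}` to `{U < a}` is bounded. -/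
lemma exists_iterate_lt {X : Type*} {W δ : X → ℝ} {next : X → X}
    (hδ : ∀ x, 0 < δ x) (hdec : ∀ x, W (next x) ≤ W x - δ x)
    (hunif : ∀ a > 0, ∀ b, ∃ c > 0, ∀ x, a ≤ W x → W x ≤ b → c ≤ δ x) {a : ℝ} (ha : 0 < a)
    (b : ℝ) : ∃ N : ℕ, ∀ x, W x ≤ b → W (next^[N] x) < a := by
  obtain ⟨c, hc, h⟩ := hunif a ha b
  obtain ⟨N, hN⟩ := exists_nat_gt (b / c)
  rw [div_lt_iff₀ hc] at hN
  refine ⟨N, fun x hx => ?_⟩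
  by_contra! hge
  have hanti : Antitone fun k => W (next^[k] x) := antitone_nat_of_succ_le fun k => by
    rw [Function.iterate_succ_apply']
    linarith [hdec (next^[k] x), hδ (next^[k] x)]
  have hle : ∀ j ≤ N, W (next^[j] x) ≤ b - j * c := by
    intro j
    induction j with
    | zero => intro _; simpa using hx
    | succ j ih =>
      intro hj
      have h1 := ih (by omega)
      have h2 := h (next^[j] x) (hge.trans (hanti (by omega)))
        ((hanti (Nat.zero_le j)).trans hx)
      rw [Function.iterate_succ_apply']
      push_cast
      linarith [hdec (next^[j] x)]
  linarith [hle N le_rfl]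

end Selection

/-! ### Comparison of a control Lyapunov function with the distance from the target -/

section Comparison

variable {n m : ℕ} {f₀ : State n → State n} {f : Fin m → State n → State n}
  {𝒯 : Set (State n)} {U : State n → ℝ}

/-- `U` has a positive minimum on the compact set where `U ≤ 1` and the distance is at least `ε`,
unless that set is empty. -/
lemma IsDegreeTwoCLF.infDist_le_of_lt (hU : IsDegreeTwoCLF f₀ f 𝒯 U) {ε : ℝ} (hε : 0 < ε) :
    ∃ a > 0, ∀ x ∉ 𝒯, U x < a → Metric.infDist x 𝒯 ≤ ε := by
  set K := {x | x ∈ closure 𝒯ᶜ ∧ U x ∈ Icc 0 1} ∩ {x | ε ≤ Metric.infDist x 𝒯} with hKdef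
  have hK : IsCompact K := (hU.proper (Icc 0 1) isCompact_Icc fun u hu => hu.1).inter_right
    (isClosed_le continuous_const (Metric.continuous_infDist_pt 𝒯))
  have hmem : ∀ x ∉ 𝒯, U x ≤ 1 → ε ≤ Metric.infDist x 𝒯 → x ∈ K := fun x hx h1 h2 =>
    ⟨⟨subset_closure hx, (hU.pos x hx).le, h1⟩, h2⟩
  rcases K.eq_empty_or_nonempty with h | h
  · refine ⟨1, one_pos, fun x hx hx1 => ?_⟩
    by_contra! hgt
    have := hmem x hx hx1.le hgt.le
    rw [h] at this
    exact this
  · obtain ⟨z, hz, hmin⟩ := hK.exists_isMinOn h (hU.continuousOn.mono fun x hx => hx.1.1)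
    have hz𝒯 : z ∉ 𝒯 := fun h => by
      have : ε ≤ Metric.infDist z 𝒯 := hz.2
      rw [Metric.infDist_zero_of_mem h] at this
      linarith
    refine ⟨min 1 (U z), lt_min one_pos (hU.pos z hz𝒯), fun x hx hxa => ?_⟩
    by_contra! hgt
    have h1 : U z ≤ U x := hmin (hmem x hx (hxa.le.trans (min_le_left _ _)) hgt.le)
    exact absurd (hxa.trans_le (min_le_right _ _)) (not_lt.2 h1)

lemma IsDegreeTwoCLF.infDist_bdd (hU : IsDegreeTwoCLF f₀ f 𝒯 U) (b : ℝ) :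
    ∃ M, ∀ x ∉ 𝒯, U x ≤ b → Metric.infDist x 𝒯 ≤ M := by
  obtain ⟨M, hM⟩ := (hU.proper (Icc 0 b) isCompact_Icc fun u hu => hu.1).exists_bound_of_continuousOn
    (Metric.continuous_infDist_pt 𝒯).continuousOn
  exact ⟨M, fun x hx hb => (le_abs_self _).trans (hM x ⟨subset_closure hx, (hU.pos x hx).le, hb⟩)⟩

lemma exists_mem_frontier_infDist_eq_dist {x : State n} (hne : 𝒯.Nonempty) (hx : x ∉ 𝒯) :
    ∃ z ∈ frontier 𝒯, Metric.infDist x 𝒯 = dist x z := by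
  have := exists_mem_frontier_infDist_compl_eq_dist (s := 𝒯ᶜ) hx
    (fun h => by obtain ⟨t, ht⟩ := hne; exact (h ▸ mem_univ t : t ∈ 𝒯ᶜ) ht)
  rwa [frontier_compl, compl_compl] at this

/-- The points outside of the target at distance at most `R` form a set with compact closure. -/
lemma isCompact_closure_infDist_le (hfr : IsCompact (frontier 𝒯)) (hne : 𝒯.Nonempty) (R : ℝ) :
    IsCompact (closure 𝒯ᶜ ∩ {x | Metric.infDist x 𝒯 ≤ R}) := by
  refine Metric.isCompact_of_isClosed_isBounded (isClosed_closure.inter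
    (isClosed_le (Metric.continuous_infDist_pt 𝒯) continuous_const)) ?_
  refine (hfr.isBounded.cthickening (δ := R)).union hfr.isBounded |>.subset ?_
  rintro x ⟨hx, hxR⟩
  by_cases h : x ∈ 𝒯
  · exact Or.inr (by rw [frontier_eq_closure_inter_closure]; exact ⟨subset_closure h, hx⟩)
  · obtain ⟨z, hz, hd⟩ := exists_mem_frontier_infDist_eq_dist hne h
    exact Or.inl (Metric.mem_cthickening_of_dist_le x z R _ hz (hd ▸ hxR))

lemma IsDegreeTwoCLF.bdd_of_infDist_le (hU : IsDegreeTwoCLF f₀ f 𝒯 U)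
    (hfr : IsCompact (frontier 𝒯)) (hne : 𝒯.Nonempty) (R : ℝ) :
    ∃ b, ∀ x ∉ 𝒯, Metric.infDist x 𝒯 ≤ R → U x ≤ b := by
  obtain ⟨b, hb⟩ := (isCompact_closure_infDist_le hfr hne R).exists_bound_of_continuousOn
    (hU.continuousOn.mono inter_subset_left)
  exact ⟨b, fun x hx hR => (le_abs_self _).trans (hb x ⟨subset_closure hx, hR⟩)⟩

/-- The converse comparison: the distance has a positive minimum where it is at most `1` and `U ≥
ε`, compact because `∂𝒯` is, unless that set is empty. -/
lemma IsDegreeTwoCLF.le_of_infDist_le (hU : IsDegreeTwoCLF f₀ f 𝒯 U) (h𝒯 : IsClosed 𝒯)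
    (hfr : IsCompact (frontier 𝒯)) (hne : 𝒯.Nonempty) {ε : ℝ} (hε : 0 < ε) :
    ∃ r > 0, ∀ x ∉ 𝒯, Metric.infDist x 𝒯 ≤ r → U x ≤ ε := by
  set K := (closure 𝒯ᶜ ∩ {x | Metric.infDist x 𝒯 ≤ 1}) ∩ (U ⁻¹' Ici ε) with hKdef
  have hK1 := isCompact_closure_infDist_le hfr hne 1
  have hK : IsCompact K := hK1.of_isClosed_subset
    ((hU.continuousOn.mono inter_subset_left).preimage_isClosed_of_isClosed hK1.isClosed
      isClosed_Ici) inter_subset_left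
  have hmem : ∀ x ∉ 𝒯, Metric.infDist x 𝒯 ≤ 1 → ε ≤ U x → x ∈ K := fun x hx h1 h2 =>
    ⟨⟨subset_closure hx, h1⟩, h2⟩
  rcases K.eq_empty_or_nonempty with h | h
  · refine ⟨1, one_pos, fun x hx hx1 => ?_⟩
    by_contra! hgt
    have := hmem x hx hx1 hgt.le
    rw [h] at this
    exact this
  · obtain ⟨z, hz, hmin⟩ := hK.exists_isMinOn h (Metric.continuous_infDist_pt 𝒯).continuousOn
    have hz𝒯 : z ∉ 𝒯 := fun h => by
      have h0 := hU.zero_frontier z (by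
        rw [frontier_eq_closure_inter_closure]; exact ⟨subset_closure h, hz.1.1⟩)
      have : ε ≤ U z := hz.2
      linarith
    have hzpos : 0 < Metric.infDist z 𝒯 := (h𝒯.notMem_iff_infDist_pos hne).1 hz𝒯
    refine ⟨min 1 (Metric.infDist z 𝒯 / 2), by positivity, fun x hx hxa => ?_⟩
    by_contra! hgt
    have h1 : Metric.infDist z 𝒯 ≤ Metric.infDist x 𝒯 :=
      hmin (hmem x hx (hxa.trans (min_le_left _ _)) hgt.le)
    have h2 := hxa.trans (min_le_right _ _)
    linarith

end Comparison

/-! ### Global asymptotic controllability -/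

section Main

variable {n m : ℕ} {f₀ : State n → State n} {f : Fin m → State n → State n}
  {𝒯 : Set (State n)} {U : State n → ℝ}

/-- The trajectory that follows the selected steps from `x`. -/
lemma exists_trajectory {next : {x // x ∉ 𝒯} → {x // x ∉ 𝒯}} {τ δ : {x // x ∉ 𝒯} → ℝ}
    (hstep : ∀ x, 0 < δ x ∧ DecreaseStep f₀ f 𝒯 U (δ x) x (τ x) (next x)) (z : State n)
    (x : {x // x ∉ 𝒯}) :
    ∃ (T : EReal) (y : ℝ → State n) (α : ℝ → Fin m → ℝ),
      Measurable α ∧ (∀ t, α t ∈ controlSet m) ∧ 0 < T ∧ IsSolution f₀ f 𝒯 x α T y ∧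
      (∀ t : ℝ, T ≤ (t : EReal) → y t = z) ∧
      ∀ N : ℕ, ∃ s : ℝ, 0 ≤ s ∧ s ≤ N ∧ (s : EReal) < T ∧
        ∀ t : ℝ, s ≤ t → (t : EReal) < T → y t ∉ 𝒯 ∧ U (y t) ≤ 2 * U (next^[N] x) := by
  have hτ : ∀ x, 0 < τ x := fun x => (hstep x).2.pos (hstep x).1
  have hanti : Antitone fun k => U (next^[k] x) := antitone_nat_of_succ_le fun k => by
    rw [Function.iterate_succ_apply']
    linarith [(hstep (next^[k] x)).2.2.2, (hstep (next^[k] x)).1]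
  obtain ⟨T, y, α, hαm, hαA, hy0, hsT, hTs, harc, hz, hV⟩ := exists_concatenation
    (V := fun k => {w | w ∉ 𝒯 ∧ U w ≤ 2 * U (next^[k] x)})
    (x := fun k => ((next^[k] x : {x // x ∉ 𝒯}) : State n)) (τ := fun k => τ (next^[k] x))
    (f₀ := f₀) (f := f) (fun k => hτ _)
    (fun k => by rw [Function.iterate_succ_apply']; exact (hstep (next^[k] x)).2.2.1) z
  set s : ℕ → ℝ := fun k => ∑ i ∈ Finset.range k, τ (next^[i] x) with hs
  have hs0 : s 0 = 0 := by simp [hs]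
  have hsm : StrictMono s := strictMono_nat_of_lt_succ fun k => by
    rw [hs]; dsimp only; rw [Finset.sum_range_succ]; linarith [hτ (next^[k] x)]
  -- Each step lasts at most `1`, so a bound on the number of steps is a bound on the time.
  have hsN : ∀ N : ℕ, s N ≤ N := fun N => by
    have := Finset.sum_le_card_nsmul (Finset.range N) (fun i => τ (next^[i] x)) 1
      fun i _ => (hstep _).2.1
    simpa using this
  have hs_nonneg : ∀ k, 0 ≤ s k := fun k => hs0 ▸ hsm.monotone (Nat.zero_le k)
  refine ⟨T, y, α, hαm, hαA, by simpa [hs0] using hsT 0, ⟨?_, fun t ht0 htT => ?_⟩, hz, fun N =>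
    ⟨s N, hs_nonneg N, hsN N, hsT N, fun t hst htT => ?_⟩⟩
  · rintro t ⟨ht0, htT⟩
    obtain ⟨k, hk⟩ := hTs t htT
    refine ((harc k).1 t ⟨ht0, hk.le⟩).mono_of_mem_nhdsWithin ?_
    refine mem_of_superset (inter_mem self_mem_nhdsWithin
      (mem_nhdsWithin_of_mem_nhds (Iio_mem_nhds hk))) fun r hr => ⟨hr.1.1, le_of_lt hr.2⟩
  · obtain ⟨k, hk⟩ := hTs t htT
    obtain ⟨hmem, hi, he⟩ := (harc k).2 t ⟨ht0, hk.le⟩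
    obtain ⟨j, hj⟩ := mem_iUnion.1 hmem
    refine ⟨hj.1, hi, ?_⟩
    rw [he, hy0]
    rfl
  · classical
    have hex := hTs t htT
    obtain ⟨k, hk⟩ : ∃ k, Nat.find hex = k + 1 := Nat.exists_eq_succ_of_ne_zero fun h => by
      have h1 := Nat.find_spec hex
      rw [h] at h1
      exact absurd ((hs_nonneg N).trans hst) (not_le.2 (hs0 ▸ h1))
    have h1 : t < s (k + 1) := hk ▸ Nat.find_spec hex
    have h2 : s k ≤ t := not_lt.1 (Nat.find_min hex (by omega))
    have hNk : N ≤ k := Nat.lt_succ_iff.1 (hsm.lt_iff_lt.1 (hst.trans_lt h1))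
    obtain ⟨h3, h4⟩ := hV k t ⟨h2, h1.le⟩
    exact ⟨h3, h4.trans (by have := hanti hNk; dsimp only at this; linarith)⟩

/-- A control Lyapunov function of degree two makes the system globally asymptotically controllable
to the target. -/
theorem IsDegreeTwoCLF.isGAC (hU : IsDegreeTwoCLF f₀ f 𝒯 U) (h𝒯 : IsClosed 𝒯)
    (hfr : IsCompact (frontier 𝒯)) (hne : 𝒯.Nonempty) (h₀ : ∀ x ∉ 𝒯, ContDiffAt ℝ 1 f₀ x)
    (hf : ∀ i, ∀ x ∉ 𝒯, ContDiffAt ℝ 1 (f i) x) : IsGAC f₀ f 𝒯 := by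
  obtain ⟨next, τ, δ, hstep, hunif⟩ := hU.exists_selection h𝒯 hne h₀ hf
  have hcount : ∀ a > 0, ∀ b, ∃ N : ℕ, ∀ x : {x // x ∉ 𝒯}, U x ≤ b → U (next^[N] x) < a :=
    fun a ha b => exists_iterate_lt (W := fun x : {x // x ∉ 𝒯} => U x) (fun x => (hstep x).1)
      (fun x => (hstep x).2.2.2) hunif ha b
  -- Any point of `∂𝒯` may prolong the trajectory; one nearest to `x` is merely at hand.
  choose z hz _ using fun x : {x // x ∉ 𝒯} => exists_mem_frontier_infDist_eq_dist hne x.2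
  choose T y α hαm hαA hT hsol hTz hN using fun x => exists_trajectory hstep (z x) x
  have hdist_T : ∀ x, ∀ t : ℝ, T x ≤ t → Metric.infDist (y x t) 𝒯 = 0 := fun x t ht => by
    rw [hTz x t ht]
    exact Metric.infDist_zero_of_mem (h𝒯.frontier_subset (hz x))
  have hovershoot : ∀ x, ∀ t : ℝ, 0 ≤ t → (t : EReal) < T x →
      y x t ∉ 𝒯 ∧ U (y x t) ≤ 2 * U x := fun x t ht htT => by
    obtain ⟨s, hs0, hs, -, h⟩ := hN x 0
    exact h t (hs.trans (by simpa using ht)) htT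
  have hstable : ∀ ε > 0, ∃ r > 0, ∀ x : {x // x ∉ 𝒯}, Metric.infDist (x : State n) 𝒯 ≤ r →
      ∀ t : ℝ, 0 ≤ t → Metric.infDist (y x t) 𝒯 ≤ ε := by
    intro ε hε
    obtain ⟨a, ha, h⟩ := hU.infDist_le_of_lt hε
    obtain ⟨r, hr, h'⟩ := hU.le_of_infDist_le h𝒯 hfr hne (show 0 < a / 3 by positivity)
    refine ⟨r, hr, fun x hx t ht => ?_⟩
    rcases le_or_gt (T x) t with hTt | htT
    · exact (hdist_T x t hTt).trans_le hε.le
    · obtain ⟨h1, h2⟩ := hovershoot x t ht htT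
      exact h _ h1 (by linarith [h' x x.2 hx])
  have hbdd : ∀ R, ∃ M, ∀ x : {x // x ∉ 𝒯}, Metric.infDist (x : State n) 𝒯 ≤ R →
      ∀ t : ℝ, 0 ≤ t → Metric.infDist (y x t) 𝒯 ≤ M := by
    intro R
    obtain ⟨b, hb⟩ := hU.bdd_of_infDist_le hfr hne R
    obtain ⟨M, hM⟩ := hU.infDist_bdd (2 * b)
    refine ⟨max M 0, fun x hx t ht => ?_⟩
    rcases le_or_gt (T x) t with hTt | htT
    · exact (hdist_T x t hTt).trans_le (le_max_right _ _)
    · obtain ⟨h1, h2⟩ := hovershoot x t ht htT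
      exact (hM _ h1 (by linarith [hb x x.2 hx])).trans (le_max_left _ _)
  have hattr : ∀ R, ∀ ε > 0, ∃ N, ∀ x : {x // x ∉ 𝒯}, Metric.infDist (x : State n) 𝒯 ≤ R →
      ∀ t : ℝ, 0 ≤ t → N ≤ t → Metric.infDist (y x t) 𝒯 ≤ ε := by
    intro R ε hε
    obtain ⟨b, hb⟩ := hU.bdd_of_infDist_le hfr hne R
    obtain ⟨a, ha, h⟩ := hU.infDist_le_of_lt hε
    -- The half compensates the doubling of `U` within a step. The same `N` then serves as number of
    -- steps and as waiting time.
    obtain ⟨N, hNb⟩ := hcount (a / 2) (by positivity) b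
    refine ⟨N, fun x hx t ht hNt => ?_⟩
    rcases le_or_gt (T x) t with hTt | htT
    · exact (hdist_T x t hTt).trans_le hε.le
    · obtain ⟨s, hs0, hs, -, h'⟩ := hN x N
      obtain ⟨h1, h2⟩ := h' t (hs.trans hNt) htT
      exact h _ h1 (by linarith [hNb x (hb x x.2 hx)])
  obtain ⟨β, hβ, hle⟩ := exists_isKL_bound
    (d := fun x : {x // x ∉ 𝒯} => Metric.infDist (x : State n) 𝒯)
    (D := fun x t => Metric.infDist (y x t) 𝒯) (fun x => Metric.infDist_nonneg)
    hstable hbdd hattr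
  refine ⟨β, hβ, fun x hx => ⟨T ⟨x, hx⟩, y ⟨x, hx⟩, α ⟨x, hx⟩, ⟨hαm _, fun t _ => hαA _ t, hT _,
    hsol _, fun ε hε => ?_⟩, ⟨z ⟨x, hx⟩, hz _, hTz _⟩, fun t ht => hle ⟨x, hx⟩ t ht⟩⟩
  obtain ⟨a, ha, h⟩ := hU.infDist_le_of_lt (half_pos hε)
  obtain ⟨N, hNb⟩ := hcount (a / 2) (by positivity) (U x)
  obtain ⟨s, hs0, -, hsT, h'⟩ := hN ⟨x, hx⟩ N
  refine ⟨s, hs0, hsT, fun t hst htT => ?_⟩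
  obtain ⟨h1, h2⟩ := h' t hst.le htT
  exact (h _ h1 (by linarith [hNb ⟨x, hx⟩ le_rfl])).trans_lt (half_lt_self hε)

end Main

end DriftCLF

theorem theorem5p1 {n m : ℕ} (𝒯 : Set (DriftCLF.State n))
    (h𝒯_closed : IsClosed 𝒯) (h𝒯_frontier : IsCompact (frontier 𝒯)) (h𝒯_nonempty : 𝒯.Nonempty)
    (f₀ : DriftCLF.State n → DriftCLF.State n)
    (f : Fin m → DriftCLF.State n → DriftCLF.State n)
    (hf₀ : ∀ Ω : Set (DriftCLF.State n), IsOpen Ω → Bornology.IsBounded Ω →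
      DriftCLF.IsCOneBounded (Ω \ 𝒯) f₀)
    (hf : ∀ i : Fin m, ∀ Ω : Set (DriftCLF.State n), IsOpen Ω → Bornology.IsBounded Ω →
      DriftCLF.IsCOneBounded (Ω \ 𝒯) (f i))
    (hU : ∃ U : DriftCLF.State n → ℝ, DriftCLF.IsDegreeTwoCLF f₀ f 𝒯 U) :
    DriftCLF.IsGAC f₀ f 𝒯 := by
  obtain ⟨U, hU⟩ := hU
  exact hU.isGAC h𝒯_closed h𝒯_frontier h𝒯_nonempty
    (fun _ hx => DriftCLF.contDiffAt_of_isCOneBounded h𝒯_closed hf₀ hx)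
    fun i _ hx => DriftCLF.contDiffAt_of_isCOneBounded h𝒯_closed (hf i) hx
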